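/- **Setting.** In the Gaussian white noise model in sequence form one observes $X^n=(X^n_j)_{j\ge1}$, $X_j^n=\theta_{0j}+n^{-1/2}\xi_j$, with $\xi_j$ i.i.d. $N(0,1)$ and $\theta_0\in\ell^2$; $P_\theta^{(n)}$ is the law under $\theta$, $\mathbb E_0^{(n)}$ the expectation under $P_{\theta_0}^{(n)}$, $\theta_{0j}$ (as a sequence) the projection of $\theta_0$ on its first $j$ coordinates, and $p_0^{(n)},p_{0j}^{(n)}$ the densities at $\theta_0$ and at this projection. Let $K(p,q)=\int p\log(p/q)$ and $V_{m,0}(p,q)=\int p\,|\log(p/q)-K(p,q)|^m$. For each $n$ let $\Pi=\sum_{k\ge1}\pi(k)\Pi_k$ be a sieve prior, where $\pi$ is a probability on $\{1,2,\dots\}$ and $\Pi_k$ is the law on $\mathbb R^k$ (extended by zeros) with density $\prod_{j\le k}\tau_j^{-1}g(\theta_j/\tau_j)$, for a probability density $g$ on $\mathbb R$ and scales $\tau_j>0$; $\pi,g,\tau$ may depend on $n$. The posterior $\Pi(\cdot\mid X^n)$ is defined by Bayes' formula, and the expected posterior risk is $\mathcal R_n(\theta_0)=\mathbb E_0^{(n)}\Pi(\|\theta-\theta_0\|_2^2\mid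 X^n)$. Let $L$ be slowly varying at infinity with, for $x$ large, $c\le L(x)\le\log x$ for some $c>0$. Fix $j_0>0$, $M_0>1$ and $m\ge5$. For positive $\epsilon_n$ put $j_n=\lfloor j_0n\epsilon_n^2/\log n\rfloor$ and $k_n=\lfloor M_0j_n\log n/L(n)\rfloor$. Condition $(A_5)$ for $\theta_0$ and $\epsilon_n$ says that, with positive constants $a,b,G_1,\dots,G_4,H_2,\alpha,\tau_0,C$ that do not depend on $n$, for all $n$ large enough: $e^{-akL(k)}\le\pi(k)\le e^{-bkL(k)}$ for all $k\ge1$; $G_1e^{-G_2|t|^\alpha}\le g(t)\le G_3e^{-G_4|t|^\alpha}$ for all $t\in\mathbb R$; $\sup_j\tau_j\le\tau_0$; $\min_{j\le k_n}\tau_j\ge n^{-H_2}$; $\sum_{j\le j_n}|\theta_{0j}|^\alpha/\tau_j^\alpha\le Cj_n\log n$ (here $\theta_{0j}$ is the $j$-th coordinate). **Proposition.** (i) Let $\theta_0\in\ell^2$ and let $\epsilon_n>0$ satisfy $\epsilon_n\to0$ and $n\epsilon_n^2/\log n\to\infty$. Assume that, for $n$ large, $K(p_0^{(n)},p_{0j_n}^{(n)})\le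 n\epsilon_n^2$ and $V_{m,0}(p_0^{(n)},p_{0j_n}^{(n)})\le(n\epsilon_n^2)^{m/2}$, and that $(A_5)$ holds for $\theta_0$ and $\epsilon_n$. Then $$\mathcal R_n(\theta_0)=\mathcal O(\epsilon_n^2).$$ (ii) (Risk adaptation, up to a $\log n$ factor.) Let $\beta_2\ge\beta_1>1/2$, $L_0>0$, $\epsilon_0>0$, let $\Theta_\beta(L_0)=\{\theta:\sum_{j\ge1}\theta_j^2j^{2\beta}<L_0\}$ and $\epsilon_n(\beta)=\epsilon_0(\log n/n)^{\beta/(2\beta+1)}$, and let $j_n,k_n$ be defined from $\epsilon_n(\beta)$. Assume that there is $C_0>0$ such that for $n$ large, for all $\beta\in[\beta_1,\beta_2]$ and $\theta_0\in\Theta_\beta(L_0)$, $$K(p_0^{(n)},p_{0j_n}^{(n)})\le C_0n\|\theta_0-\theta_{0j_n}\|_2^2,\qquad V_{m,0}(p_0^{(n)},p_{0j_n}^{(n)})\le C_0^mn^{m/2}\|\theta_0-\theta_{0j_n}\|_2^m,$$ and that $(A_5)$ holds for $\theta_0$ and $\epsilon_n(\beta)$ with constants, and from an $n$ on, that do not depend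 on such $\beta,\theta_0$. Then there is a constant $C'$ such that for all $n$ large enough $$\mathcal R_n(\theta_0)\le C'\epsilon_n(\beta)^2\qquad\text{for all }\beta\in[\beta_1,\beta_2],\ \theta_0\in\Theta_\beta(L_0).$$ -/

import Mathlib

open MeasureTheory ProbabilityTheory Filter Topology
open scoped ENNReal NNReal

noncomputable section

namespace WhiteNoise

/-- Real sequences. The coordinate written `θ_j`, `j = 1, 2, …`, is the value at `j - 1`. -/
abbrev Seq : Type := ℕ → ℝ

/-! ### The Gaussian white noise model in sequence form -/

/-- The law of the observation `X_j = θ_j + n^{-1/2} ξ_j`, `j = 1, 2, …`, with `ξ_j` independent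
standard Gaussian variables. -/
def law (n : ℕ) (θ : Seq) : Measure Seq :=
  Measure.infinitePi fun i => gaussianReal (θ i) ((n : ℝ≥0)⁻¹)

/-- The likelihood `exp (n ⟨θ, x⟩ - n ‖θ‖² / 2)`, the density of `law n θ` with respect to
`law n 0`. It is only used for `θ` with finitely many nonzero coordinates, the ones that a sieve
prior charges, so that both series are finite sums. -/
def likelihood (n : ℕ) (θ x : Seq) : ℝ≥0∞ :=
  ENNReal.ofReal (Real.exp (n * (∑' i, θ i * x i) - n / 2 * ∑' i, θ i ^ 2))

/-- The squared `ℓ²` distance `‖θ - θ'‖²`, with value `∞` if the difference is not in `ℓ²`. -/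
def sqDist (θ θ' : Seq) : ℝ≥0∞ := ∑' i, ENNReal.ofReal ((θ i - θ' i) ^ 2)

/-- The projection on the first `k` coordinates. -/
def proj (k : ℕ) (θ : Seq) : Seq := fun i => if i < k then θ i else 0

/-- The Sobolev class `{θ : ∑_{j ≥ 1} θ_j² j^{2β} < L₀}`. -/
def sobolevClass (β L₀ : ℝ) : Set Seq :=
  {θ | Summable (fun i : ℕ => θ i ^ 2 * ((i : ℝ) + 1) ^ (2 * β)) ∧
    ∑' i : ℕ, θ i ^ 2 * ((i : ℝ) + 1) ^ (2 * β) < L₀}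

/-! ### Divergences -/

/-- The centered moment `V_{m,0}(p, q) = ∫ p |log (p / q) - K(p, q)|^m`, where `K` is the
Kullback-Leibler divergence. (It is only used together with a finite bound on `K`, which
includes `P ≪ Q`.) -/
def centeredMoment {𝓧 : Type*} [MeasurableSpace 𝓧] (m : ℝ) (P Q : Measure 𝓧) : ℝ≥0∞ :=
  ∫⁻ x, ENNReal.ofReal (|llr P Q x - (InformationTheory.klDiv P Q).toReal| ^ m) ∂P

/-! ### Sieve priors and posteriors -/

/-- The data of a sieve prior: a probability `weight` on the dimensions `k = 1, 2, …`, positive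
scales `τ_j`, and a probability density `g` on the line. -/
structure SievePrior where
  weight : ℕ → ℝ
  weight_nonneg : ∀ k, 0 ≤ weight k
  weight_zero : weight 0 = 0
  weight_hasSum : HasSum weight 1
  scale : ℕ → ℝ
  scale_pos : ∀ i, 0 < scale i
  density : ℝ → ℝ
  density_measurable : Measurable density
  density_nonneg : ∀ t, 0 ≤ density t
  density_lintegral : ∫⁻ t, ENNReal.ofReal (density t) = 1

/-- The inclusion of `ℝ^k` into the space of sequences. -/
def extendZero (k : ℕ) (v : Fin k → ℝ) : Seq := fun i => if h : i < k then v ⟨i, h⟩ else 0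

theorem measurable_extendZero (k : ℕ) : Measurable (extendZero k) := by
  refine measurable_pi_lambda _ fun i => ?_
  by_cases h : i < k
  · simpa [extendZero, h] using measurable_pi_apply _
  · simp [extendZero, h]

/-- `Π_k`: the distribution on `ℝ^k` with Lebesgue density `∏_{j ≤ k} g (θ_j / τ_j) / τ_j`,
as a measure on sequences that vanish after the `k`-th coordinate. -/
def SievePrior.component (Pr : SievePrior) (k : ℕ) : Measure Seq :=
  ((volume : Measure (Fin k → ℝ)).withDensity fun v =>
    ∏ i : Fin k, ENNReal.ofReal (1 / Pr.scale i * Pr.density (v i / Pr.scale i))).map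
      (extendZero k)

/-- The sieve prior `Π = ∑_k π(k) Π_k`. -/
def SievePrior.measure (Pr : SievePrior) : Measure Seq :=
  Measure.sum fun k => ENNReal.ofReal (Pr.weight k) • Pr.component k

/-- The posterior distribution
`Π(B | x) = ∫_B p_θ(x) dΠ(θ) / ∫ p_θ(x) dΠ(θ)`. -/
def SievePrior.posterior (Pr : SievePrior) (n : ℕ) (x : Seq) : Measure Seq :=
  (∫⁻ θ, likelihood n θ x ∂Pr.measure)⁻¹ •
    Pr.measure.withDensity fun θ => likelihood n θ x

/-- The expected posterior risk `E₀ Π(‖θ - θ₀‖² | X^n)`. -/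
def SievePrior.posteriorRisk (Pr : SievePrior) (n : ℕ) (θ₀ : Seq) : ℝ≥0∞ :=
  ∫⁻ x, ∫⁻ θ, sqDist θ θ₀ ∂(Pr.posterior n x) ∂(law n θ₀)

/-! ### Conditions -/

/-- Slowly varying functions at infinity (Karamata). -/
def IsSlowlyVarying (L : ℝ → ℝ) : Prop :=
  Measurable L ∧ (∀ᶠ x in atTop, 0 < L x) ∧
    ∀ c : ℝ, 0 < c → Tendsto (fun x => L (c * x) / L x) atTop (𝓝 1)

/-- `j_n = ⌊j₀ n ε² / log n⌋`, where `e` is the rate `ε_n` at `n`. -/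
def cutoff (j₀ : ℝ) (n : ℕ) (e : ℝ) : ℕ := ⌊j₀ * n * e ^ 2 / Real.log n⌋₊

/-- `k_n = ⌊M₀ j_n log n / L(n)⌋`, where `e` is the rate `ε_n` at `n`. -/
def upperCutoff (L : ℝ → ℝ) (j₀ M₀ : ℝ) (n : ℕ) (e : ℝ) : ℕ :=
  ⌊M₀ * cutoff j₀ n e * Real.log n / L n⌋₊

/-- `ε_n(β) = ε₀ (log n / n)^{β / (2β + 1)}`. -/
def sobolevRate (ε₀ β : ℝ) (n : ℕ) : ℝ := ε₀ * (Real.log n / n) ^ (β / (2 * β + 1))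

/-- The positive constants of the condition on the prior. -/
structure PriorConstants where
  (a b G₁ G₂ G₃ G₄ H₂ α τ₀ C : ℝ)
  a_pos : 0 < a
  b_pos : 0 < b
  G₁_pos : 0 < G₁
  G₂_pos : 0 < G₂
  G₃_pos : 0 < G₃
  G₄_pos : 0 < G₄
  H₂_pos : 0 < H₂
  α_pos : 0 < α
  τ₀_pos : 0 < τ₀
  C_pos : 0 < C

/-- The condition on the prior at sample size `n`, for the true parameter `θ₀`, the cutoffs `jn`
and `kn`, and the constants `c`. -/
structure PriorCondition (c : PriorConstants) (L : ℝ → ℝ) (Pr : SievePrior)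
    (n jn kn : ℕ) (θ₀ : Seq) : Prop where
  weight_lower : ∀ k : ℕ, 1 ≤ k → Real.exp (-c.a * k * L k) ≤ Pr.weight k
  weight_upper : ∀ k : ℕ, 1 ≤ k → Pr.weight k ≤ Real.exp (-c.b * k * L k)
  density_lower : ∀ t : ℝ, c.G₁ * Real.exp (-c.G₂ * |t| ^ c.α) ≤ Pr.density t
  density_upper : ∀ t : ℝ, Pr.density t ≤ c.G₃ * Real.exp (-c.G₄ * |t| ^ c.α)
  scale_upper : ∀ i, Pr.scale i ≤ c.τ₀
  scale_lower : ∀ i < kn, (n : ℝ) ^ (-c.H₂) ≤ Pr.scale i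
  sum_bound : ∑ i ∈ Finset.range jn, |θ₀ i| ^ c.α / Pr.scale i ^ c.α ≤ c.C * jn * Real.log n

/-- Bounds `K(p_0, p_{0 jn}) ≤ n ε²` and `V_{m,0}(p_0, p_{0 jn}) ≤ (n ε²)^{m/2}` between the true
law and the law at the projection of `θ₀` on `jn` coordinates, where `e` is the rate. -/
def ApproximationCondition (m : ℝ) (n jn : ℕ) (e : ℝ) (θ₀ : Seq) : Prop :=
  InformationTheory.klDiv (law n θ₀) (law n (proj jn θ₀)) ≤ ENNReal.ofReal (n * e ^ 2) ∧
  centeredMoment m (law n θ₀) (law n (proj jn θ₀)) ≤ ENNReal.ofReal ((n * e ^ 2) ^ (m / 2))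

/-- The comparison of divergences with the `ℓ²` norm,
`K(p_0, p_{0 jn}) ≤ C₀ n ‖θ₀ - θ_{0 jn}‖²` and
`V_{m,0}(p_0, p_{0 jn}) ≤ C₀^m n^{m/2} ‖θ₀ - θ_{0 jn}‖^m`. -/
def ComparisonCondition (m C₀ : ℝ) (n jn : ℕ) (θ₀ : Seq) : Prop :=
  InformationTheory.klDiv (law n θ₀) (law n (proj jn θ₀)) ≤
    ENNReal.ofReal (C₀ * n) * sqDist θ₀ (proj jn θ₀) ∧
  centeredMoment m (law n θ₀) (law n (proj jn θ₀)) ≤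
    ENNReal.ofReal (C₀ ^ m * (n : ℝ) ^ (m / 2)) * sqDist θ₀ (proj jn θ₀) ^ (m / 2)

end WhiteNoise

end

open WhiteNoise

noncomputable section

namespace WhiteNoise

/-! The likelihood and every component of the prior factor over coordinates. The posterior is
therefore a mixture over the dimension k, and given k the retained coordinates are independent. The
risk can be bounded by explicit Gaussian computations: it is the average, under the posterior
weights `dimWeight`, of the squared errors in the first k coordinates plus the bias `tailSq` of the
others. Below, J stands for j_n and H = J log n, so that H / n is of the order of the squared rate.

In one coordinate, the evidence relative to the true Gaussian density has a lower bound valid for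
every observation (`relEvidence_ge`). The same factors bound the contribution of remote parameters
from above and cancel, so the posterior second moment is at most a multiple of the squared noise
plus (1 + |θ/τ|^α) / n (`lintegral_sq_mul_le`). By the condition on the prior, the second part sums
to O(H / n) over the first J coordinates.

For k < J, let S be the energy of θ₀ between k and J. The odds of k against J are at most exp(O(H))
over a likelihood ratio, and the square root of this bound has expectation exp(O(H) - nS/8)
(`lintegral_law_underBound`). Only dimensions whose extra bias S is O(H / n) matter. For k ≥ K, with
K a multiple of H, the prior weight exp(-bk) beats every factor exp(O(H)) and the losses are
summable in k (`tsum_lintegral_overLoss_le`). In between, the weights sum to at most 1 and the noise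
of K coordinates costs O(K / n). These bounds are collected in `posteriorRisk_le`.

The bias beyond J is O(ε²), by the bound on the Kullback-Leibler divergence in the first statement
(`sum_sq_le_klDiv`) and by Sobolev smoothness in the second (`tailSq_le_sobolevRate`). -/

/-! ### Evidence and posterior second moment in one Gaussian coordinate. -/

/-- The ratio of the marginal density of `X ~ N(t, 1/N)`, `t ~ h`, to the density of `N(ϑ, 1/N)`. -/
def relEvidence (N : ℝ) (h : ℝ → ℝ≥0∞) (ϑ x : ℝ) : ℝ≥0∞ :=
  ∫⁻ t, h t * ENNReal.ofReal (Real.exp (N * (t - ϑ) * (x - ϑ) - N / 2 * (t - ϑ) ^ 2))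

theorem measurable_relEvidence {N : ℝ} {h : ℝ → ℝ≥0∞} (hh : Measurable h) (ϑ : ℝ) :
    Measurable (relEvidence N h ϑ) := by
  unfold relEvidence
  refine Measurable.lintegral_prod_right' (f := fun p : ℝ × ℝ => h p.2 * ENNReal.ofReal
    (Real.exp (N * (p.2 - ϑ) * (p.1 - ϑ) - N / 2 * (p.2 - ϑ) ^ 2))) ?_
  fun_prop

/-- Change of the reference law from N(0, 1/N) to N(ϑ, 1/N): the prefactor is the likelihood ratio
of the two. -/
theorem relEvidence_zero {N : ℝ} {h : ℝ → ℝ≥0∞} (hh : Measurable h) (ϑ x : ℝ) :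
    relEvidence N h 0 x =
      ENNReal.ofReal (Real.exp (N * ϑ * x - N / 2 * ϑ ^ 2)) * relEvidence N h ϑ x := by
  unfold relEvidence
  rw [← lintegral_const_mul _ (by fun_prop)]
  refine lintegral_congr fun t => ?_
  rw [mul_left_comm, ← ENNReal.ofReal_mul (Real.exp_nonneg _), ← Real.exp_add]
  congr 3
  ring_nf

theorem lintegral_exp_gaussianReal (μ : ℝ) (v : ℝ≥0) (s r : ℝ) :
    ∫⁻ x, ENNReal.ofReal (Real.exp (s * x + r)) ∂gaussianReal μ v =
      ENNReal.ofReal (Real.exp (μ * s + v * s ^ 2 / 2 + r)) := by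
  have hint : Integrable (fun x => Real.exp (s * x)) (gaussianReal μ v) :=
    integrable_exp_mul_gaussianReal s
  have hm : ∫ x, Real.exp (s * x) ∂gaussianReal μ v = Real.exp (μ * s + v * s ^ 2 / 2) := by
    have := congrFun (mgf_id_gaussianReal (μ := μ) (v := v)) s
    simpa [mgf] using this
  simp_rw [Real.exp_add _ r]
  rw [← ofReal_integral_eq_lintegral_ofReal (hint.mul_const _)
    (Eventually.of_forall fun _ => by positivity), integral_mul_const, hm]

/-- A ratio of probability densities has mean one under the law in the denominator. By Tonelli it
suffices to check this for each t. -/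
theorem lintegral_relEvidence {n : ℕ} (hn : 0 < n) {h : ℝ → ℝ≥0∞} (hh : Measurable h)
    (h1 : ∫⁻ t, h t = 1) (ϑ : ℝ) :
    ∫⁻ x, relEvidence n h ϑ x ∂gaussianReal ϑ ((n : ℝ≥0)⁻¹) = 1 := by
  unfold relEvidence
  rw [lintegral_lintegral_swap (by fun_prop), ← h1]
  refine lintegral_congr fun t => ?_
  rw [lintegral_const_mul _ (by fun_prop)]
  have := lintegral_exp_gaussianReal ϑ ((n : ℝ≥0)⁻¹) (n * (t - ϑ))
    (-(n * (t - ϑ) * ϑ) - n / 2 * (t - ϑ) ^ 2)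
  have hn' : (n : ℝ) ≠ 0 := by positivity
  convert congrArg (h t * ·) this using 1
  · congr 1
    refine lintegral_congr fun x => ?_
    congr 2
    ring
  · have : ϑ * (n * (t - ϑ)) + (((n : ℝ≥0)⁻¹ : ℝ≥0) : ℝ) * (n * (t - ϑ)) ^ 2 / 2 +
        (-(n * (t - ϑ) * ϑ) - n / 2 * (t - ϑ) ^ 2) = 0 := by
      push_cast
      field_simp
      ring
    rw [this]
    simp

section Coordinate

variable {N τ G₁ G₂ G₃ α : ℝ} {h : ℝ → ℝ≥0∞}

/-- The lower bound on the prior mass near `ϑ` is of the order of this factor. -/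
def massFactor (N τ : ℝ) : ℝ := min 1 (1 / (√N * τ))

theorem massFactor_pos (hN : 0 < N) (hτ : 0 < τ) : 0 < massFactor N τ := by
  unfold massFactor
  positivity

theorem abs_add_one_rpow_le {y α : ℝ} (hy : 0 ≤ y) (hα : 0 < α) :
    (y + 1) ^ α ≤ 2 ^ α * (1 + y ^ α) := by
  have h2 : (0 : ℝ) ≤ 2 ^ α := by positivity
  rcases le_total y 1 with h | h
  · calc (y + 1) ^ α ≤ 2 ^ α := Real.rpow_le_rpow (by linarith) (by linarith) hα.le
      _ ≤ _ := le_mul_of_one_le_right h2 (by linarith [Real.rpow_nonneg hy α])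
  · calc (y + 1) ^ α ≤ (2 * y) ^ α := Real.rpow_le_rpow (by linarith) (by linarith) hα.le
      _ = 2 ^ α * y ^ α := Real.mul_rpow (by norm_num) hy
      _ ≤ _ := by gcongr; linarith

/-- Only the parameters within δ of ϑ on the same side as x are kept. There the cross term of the
exponent is nonnegative, which makes the bound uniform in the observation x. -/
theorem relEvidence_ge (hN : 0 < N) (hτ : 0 < τ) (hG₁ : 0 < G₁) (hG₂ : 0 < G₂) (hα : 0 < α)
    (hlow : ∀ t, ENNReal.ofReal (1 / τ * (G₁ * Real.exp (-G₂ * |t / τ| ^ α))) ≤ h t) (ϑ x : ℝ) :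
    ENNReal.ofReal (G₁ * Real.exp (-(1 / 2)) * massFactor N τ *
      Real.exp (-(G₂ * 2 ^ α * (1 + |ϑ / τ| ^ α)))) ≤ relEvidence N h ϑ x := by
  set s := G₂ * 2 ^ α * (1 + |ϑ / τ| ^ α) with hs
  -- This is min(τ, 1/√N): the first bound keeps t/τ within 1 of ϑ/τ, the second makes the quadratic
  -- term cost at most a factor exp(-1/2).
  set δ := massFactor N τ * τ with hδ
  have hmf := massFactor_pos hN hτ
  have hδ0 : 0 < δ := mul_pos hmf hτ
  have hδτ : δ ≤ τ := mul_le_of_le_one_left hτ.le (min_le_left _ _)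
  have hδN : N * δ ^ 2 ≤ 1 := by
    have h1 : δ ≤ 1 / √N := by
      calc δ ≤ 1 / (√N * τ) * τ := by
            rw [hδ]; exact mul_le_mul_of_nonneg_right (min_le_right _ _) hτ.le
        _ = 1 / √N := by field_simp
    calc N * δ ^ 2 ≤ N * (1 / √N) ^ 2 := by gcongr
      _ = 1 := by rw [div_pow, Real.sq_sqrt hN.le]; field_simp
  have key : ∀ t, |t - ϑ| ≤ δ → 0 ≤ (t - ϑ) * (x - ϑ) →
      ENNReal.ofReal (1 / τ * (G₁ * Real.exp (-s)) * Real.exp (-(1 / 2))) ≤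
      h t * ENNReal.ofReal (Real.exp (N * (t - ϑ) * (x - ϑ) - N / 2 * (t - ϑ) ^ 2)) := by
    intro t ht hsgn
    rw [ENNReal.ofReal_mul (by positivity)]
    refine mul_le_mul' (le_trans (ENNReal.ofReal_le_ofReal ?_) (hlow t))
      (ENNReal.ofReal_le_ofReal ?_)
    · have h1 : |t / τ| ≤ |ϑ / τ| + 1 := by
        have : t / τ = ϑ / τ + (t - ϑ) / τ := by field_simp; ring
        rw [this]
        refine (abs_add_le _ _).trans (add_le_add_right ?_ _)
        rw [abs_div, abs_of_pos hτ, div_le_one hτ]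
        exact ht.trans hδτ
      have h2 : |t / τ| ^ α ≤ 2 ^ α * (1 + |ϑ / τ| ^ α) :=
        (Real.rpow_le_rpow (abs_nonneg _) h1 hα.le).trans
          (abs_add_one_rpow_le (abs_nonneg _) hα)
      have h3 : -s ≤ -G₂ * |t / τ| ^ α := by
        rw [hs]
        nlinarith [mul_le_mul_of_nonneg_left h2 hG₂.le]
      gcongr
    · have h1 : (t - ϑ) ^ 2 ≤ δ ^ 2 := sq_le_sq' (by linarith [neg_le_of_abs_le ht])
        (le_of_abs_le ht)
      have h2 : 0 ≤ N * ((t - ϑ) * (x - ϑ)) := mul_nonneg hN.le hsgn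
      have h3 : N * (t - ϑ) ^ 2 ≤ N * δ ^ 2 := by gcongr
      gcongr
      nlinarith
  obtain ⟨I, hI, hvol, hmem⟩ : ∃ I : Set ℝ, MeasurableSet I ∧ volume I = ENNReal.ofReal δ ∧
      ∀ t ∈ I, |t - ϑ| ≤ δ ∧ 0 ≤ (t - ϑ) * (x - ϑ) := by
    rcases le_total ϑ x with hx | hx
    · refine ⟨Set.Icc ϑ (ϑ + δ), measurableSet_Icc, by simp, fun t ht => ⟨?_, ?_⟩⟩
      · rw [abs_le]; constructor <;> linarith [ht.1, ht.2]
      · exact mul_nonneg (by linarith [ht.1]) (by linarith)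
    · refine ⟨Set.Icc (ϑ - δ) ϑ, measurableSet_Icc, by simp, fun t ht => ⟨?_, ?_⟩⟩
      · rw [abs_le]; constructor <;> linarith [ht.1, ht.2]
      · exact mul_nonneg_of_nonpos_of_nonpos (by linarith [ht.2]) (by linarith)
  calc ENNReal.ofReal (G₁ * Real.exp (-(1 / 2)) * massFactor N τ * Real.exp (-s))
      = ENNReal.ofReal (1 / τ * (G₁ * Real.exp (-s)) * Real.exp (-(1 / 2))) * volume I := by
        rw [hvol, ← ENNReal.ofReal_mul (by positivity), hδ]
        congr 1
        field_simp
    _ = ∫⁻ t in I, ENNReal.ofReal (1 / τ * (G₁ * Real.exp (-s)) * Real.exp (-(1 / 2))) := by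
        rw [setLIntegral_const]
    _ ≤ ∫⁻ t in I, h t *
          ENNReal.ofReal (Real.exp (N * (t - ϑ) * (x - ϑ) - N / 2 * (t - ϑ) ^ 2)) :=
        setLIntegral_mono' hI fun t ht => key t (hmem t ht).1 (hmem t ht).2
    _ ≤ relEvidence N h ϑ x := setLIntegral_le_lintegral _ _

/-- Beyond the threshold for w² the exponent is at most -Nw²/4, hence at most -s - Nw²/8. Half of
the last term absorbs the factor w². The free parameter s is later chosen so that exp(-s) cancels
the corresponding factor in `relEvidence_ge`. -/
theorem sq_mul_exp_le {N s w u : ℝ} (hN : 0 < N) (hs : 0 ≤ s) :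
    w ^ 2 * Real.exp (N * w * u - N / 2 * w ^ 2) ≤
      (16 * u ^ 2 + 8 * s / N) * Real.exp (N * w * u - N / 2 * w ^ 2) +
        16 / N * Real.exp (-s) * Real.exp (-(N / 16) * w ^ 2) := by
  by_cases hw : w ^ 2 ≤ 16 * u ^ 2 + 8 * s / N
  · have : 0 ≤ 16 / N * Real.exp (-s) * Real.exp (-(N / 16) * w ^ 2) := by positivity
    have := mul_le_mul_of_nonneg_right hw (Real.exp_nonneg (N * w * u - N / 2 * w ^ 2))
    linarith
  · push Not at hw
    have h1 : w * u ≤ w ^ 2 / 4 := by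
      have : 16 * u ^ 2 ≤ w ^ 2 := by have : 0 ≤ 8 * s / N := by positivity
                                      linarith
      nlinarith [sq_nonneg (w - 4 * u)]
    have h2 : 8 * s ≤ N * w ^ 2 := by
      have : 8 * s / N ≤ w ^ 2 := by nlinarith [sq_nonneg u]
      rw [div_le_iff₀ hN] at this
      linarith
    have h3 : N * w * u - N / 2 * w ^ 2 ≤ -s + -(N / 16) * w ^ 2 + -(N / 16 * w ^ 2) := by
      nlinarith [mul_le_mul_of_nonneg_left h1 hN.le]
    have h4 : w ^ 2 * Real.exp (-(N / 16 * w ^ 2)) ≤ 16 / N := by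
      have h5 : N / 16 * w ^ 2 ≤ Real.exp (N / 16 * w ^ 2) := by
        linarith [Real.add_one_le_exp (N / 16 * w ^ 2)]
      rw [Real.exp_neg, ← div_eq_mul_inv, div_le_iff₀ (Real.exp_pos _)]
      calc w ^ 2 = 16 / N * (N / 16 * w ^ 2) := by field_simp
        _ ≤ _ := by gcongr
    calc w ^ 2 * Real.exp (N * w * u - N / 2 * w ^ 2)
        ≤ w ^ 2 * Real.exp (-s + -(N / 16) * w ^ 2 + -(N / 16 * w ^ 2)) := by gcongr
      _ = (w ^ 2 * Real.exp (-(N / 16 * w ^ 2))) *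
            (Real.exp (-s) * Real.exp (-(N / 16) * w ^ 2)) := by
          rw [Real.exp_add, Real.exp_add]; ring
      _ ≤ 16 / N * (Real.exp (-s) * Real.exp (-(N / 16) * w ^ 2)) := by gcongr
      _ ≤ _ := by
          have : 0 ≤ (16 * u ^ 2 + 8 * s / N) * Real.exp (N * w * u - N / 2 * w ^ 2) := by
            positivity
          linarith

theorem lintegral_exp_neg_sq_sub {b : ℝ} (hb : 0 < b) (ϑ : ℝ) :
    ∫⁻ t, ENNReal.ofReal (Real.exp (-b * (t - ϑ) ^ 2)) = ENNReal.ofReal (√(Real.pi / b)) := by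
  rw [lintegral_sub_right_eq_self (fun t => ENNReal.ofReal (Real.exp (-b * t ^ 2))) ϑ,
    ← integral_gaussian, ofReal_integral_eq_lintegral_ofReal (integrable_exp_neg_mul_sq hb)
      (Eventually.of_forall fun _ => Real.exp_nonneg _)]

/-- The two regimes of `massFactor`: either the prior is used only as a probability, or its density
is bounded by G₃/τ and the Gaussian is integrated. The order matches the lower bound in
`relEvidence_ge`, so the two cancel in a quotient. -/
theorem lintegral_mul_exp_neg_sq_le (hN : 0 < N) (hτ : 0 < τ) (hG₃ : 0 < G₃)
    (h1 : ∫⁻ t, h t = 1) (hup : ∀ t, h t ≤ ENNReal.ofReal (G₃ / τ)) (ϑ : ℝ) :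
    ∫⁻ t, h t * ENNReal.ofReal (Real.exp (-(N / 16) * (t - ϑ) ^ 2)) ≤
      ENNReal.ofReal (max 1 (4 * √Real.pi * G₃) * massFactor N τ) := by
  have hsN : 0 < √N := Real.sqrt_pos.2 hN
  rcases le_total 1 (1 / (√N * τ)) with hm | hm
  · rw [massFactor, min_eq_left hm, mul_one]
    calc _ ≤ ∫⁻ t, h t := lintegral_mono fun t => by
          refine mul_le_of_le_one_right' ?_
          rw [ENNReal.ofReal_le_one, Real.exp_le_one_iff]
          nlinarith [mul_nonneg hN.le (sq_nonneg (t - ϑ))]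
      _ ≤ _ := by
          rw [h1, ENNReal.one_le_ofReal]
          exact le_max_left _ _
  · rw [massFactor, min_eq_right hm]
    calc _ ≤ ∫⁻ t, ENNReal.ofReal (G₃ / τ) *
            ENNReal.ofReal (Real.exp (-(N / 16) * (t - ϑ) ^ 2)) :=
          lintegral_mono fun t => mul_le_mul_left (hup t) _
      _ = ENNReal.ofReal (G₃ / τ * √(Real.pi / (N / 16))) := by
          rw [lintegral_const_mul _ (by fun_prop), lintegral_exp_neg_sq_sub (by positivity),
            ENNReal.ofReal_mul (by positivity)]
      _ ≤ _ := by
          refine ENNReal.ofReal_le_ofReal ?_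
          have : √(Real.pi / (N / 16)) = 4 * √Real.pi / √N := by
            have h16 : Real.pi / (N / 16) = 4 ^ 2 * Real.pi / N := by field_simp; norm_num
            rw [h16, Real.sqrt_div (by positivity), Real.sqrt_mul (by positivity),
              Real.sqrt_sq (by norm_num)]
          rw [this]
          calc G₃ / τ * (4 * √Real.pi / √N) = 4 * √Real.pi * G₃ * (1 / (√N * τ)) := by
                field_simp
            _ ≤ _ := by gcongr; exact le_max_right _ _

/-- The constant in the bound on the posterior second moment of one coordinate. -/
def momentConst (G₁ G₂ G₃ α : ℝ) : ℝ :=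
  8 * (G₂ * 2 ^ α) + 16 * max 1 (4 * √Real.pi * G₃) * Real.exp (1 / 2) / G₁

/-- The remote part from `sq_mul_exp_le` is compared with the evidence through `relEvidence_ge`.
Both carry `massFactor` and exp(-s), so no logarithm of N appears. -/
theorem lintegral_sq_mul_le (hh : Measurable h) (hN : 0 < N) (hτ : 0 < τ) (hG₁ : 0 < G₁)
    (hG₂ : 0 < G₂) (hG₃ : 0 < G₃) (hα : 0 < α) (h1 : ∫⁻ t, h t = 1)
    (hlow : ∀ t, ENNReal.ofReal (1 / τ * (G₁ * Real.exp (-G₂ * |t / τ| ^ α))) ≤ h t)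
    (hup : ∀ t, h t ≤ ENNReal.ofReal (G₃ / τ)) (ϑ x : ℝ) :
    ∫⁻ t, ENNReal.ofReal ((t - ϑ) ^ 2) * (h t *
      ENNReal.ofReal (Real.exp (N * (t - ϑ) * (x - ϑ) - N / 2 * (t - ϑ) ^ 2))) ≤
      ENNReal.ofReal (16 * (x - ϑ) ^ 2 +
        momentConst G₁ G₂ G₃ α * (1 + |ϑ / τ| ^ α) / N) * relEvidence N h ϑ x := by
  set Λ := 1 + |ϑ / τ| ^ α with hΛ
  have hΛ1 : 1 ≤ Λ := by have := Real.rpow_nonneg (abs_nonneg (ϑ / τ)) α; linarith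
  set s := G₂ * 2 ^ α * Λ with hs
  have hs0 : 0 ≤ s := by positivity
  have hge := relEvidence_ge (x := x) hN hτ hG₁ hG₂ hα hlow ϑ
  have hmf := massFactor_pos hN hτ
  set K := max 1 (4 * √Real.pi * G₃) with hK
  have hK0 : 0 < K := lt_of_lt_of_le one_pos (le_max_left _ _)
  calc _ ≤ ∫⁻ t, (ENNReal.ofReal (16 * (x - ϑ) ^ 2 + 8 * s / N) * (h t *
            ENNReal.ofReal (Real.exp (N * (t - ϑ) * (x - ϑ) - N / 2 * (t - ϑ) ^ 2))) +
          ENNReal.ofReal (16 / N * Real.exp (-s)) *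
            (h t * ENNReal.ofReal (Real.exp (-(N / 16) * (t - ϑ) ^ 2)))) := by
        refine lintegral_mono fun t => ?_
        have := sq_mul_exp_le (w := t - ϑ) (u := x - ϑ) hN hs0
        calc _ = h t * ENNReal.ofReal ((t - ϑ) ^ 2 *
              Real.exp (N * (t - ϑ) * (x - ϑ) - N / 2 * (t - ϑ) ^ 2)) := by
              rw [ENNReal.ofReal_mul (sq_nonneg _)]; ring
          _ ≤ h t * ENNReal.ofReal _ := mul_le_mul_right (ENNReal.ofReal_le_ofReal this) _
          _ = _ := by
              rw [ENNReal.ofReal_add (by positivity) (by positivity),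
                ENNReal.ofReal_mul (by positivity),
                ENNReal.ofReal_mul (p := 16 / N * Real.exp (-s)) (by positivity)]
              ring
    _ = ENNReal.ofReal (16 * (x - ϑ) ^ 2 + 8 * s / N) * relEvidence N h ϑ x +
          ENNReal.ofReal (16 / N * Real.exp (-s)) *
            ∫⁻ t, h t * ENNReal.ofReal (Real.exp (-(N / 16) * (t - ϑ) ^ 2)) := by
        rw [lintegral_add_left (by fun_prop), lintegral_const_mul _ (by fun_prop),
          lintegral_const_mul _ (by fun_prop), relEvidence]
    _ ≤ ENNReal.ofReal (16 * (x - ϑ) ^ 2 + 8 * s / N) * relEvidence N h ϑ x +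
          ENNReal.ofReal (16 * K * Real.exp (1 / 2) / G₁ * Λ / N) * relEvidence N h ϑ x := by
        refine add_le_add_right ?_ _
        calc _ ≤ ENNReal.ofReal (16 / N * Real.exp (-s)) *
              ENNReal.ofReal (K * massFactor N τ) :=
              mul_le_mul_right (lintegral_mul_exp_neg_sq_le hN hτ hG₃ h1 hup ϑ) _
          _ ≤ ENNReal.ofReal (16 * K * Real.exp (1 / 2) / G₁ * Λ / N) *
              ENNReal.ofReal (G₁ * Real.exp (-(1 / 2)) * massFactor N τ * Real.exp (-s)) := by
              rw [← ENNReal.ofReal_mul (by positivity), ← ENNReal.ofReal_mul (by positivity)]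
              refine ENNReal.ofReal_le_ofReal ?_
              have hee : Real.exp (1 / 2) * Real.exp (-(1 / 2)) = 1 := by
                rw [← Real.exp_add]; simp
              calc 16 / N * Real.exp (-s) * (K * massFactor N τ)
                  ≤ 16 / N * Real.exp (-s) * (K * massFactor N τ) * Λ :=
                    le_mul_of_one_le_right (by positivity) hΛ1
                _ = 16 / N * Real.exp (-s) * (K * massFactor N τ) * Λ *
                    (Real.exp (1 / 2) * Real.exp (-(1 / 2))) := by rw [hee, mul_one]
                _ = _ := by field_simp
          _ ≤ _ := mul_le_mul_right hge _
    _ = _ := by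
        rw [← add_mul, ← ENNReal.ofReal_add (by positivity) (by positivity)]
        congr 2
        rw [momentConst, hs]
        field_simp
        ring

end Coordinate

/-! ### Integrals of products -/

theorem lintegral_fin_prod_eq_prod (k : ℕ) (f : Fin k → ℝ → ℝ≥0∞) (hf : ∀ i, Measurable (f i)) :
    ∫⁻ v : Fin k → ℝ, ∏ i, f i (v i) = ∏ i, ∫⁻ t, f i t := by
  induction k with
  | zero => simp [volume_pi]
  | succ k ih =>
    have hmp := (volume_preserving_piFinSuccAbove (fun _ : Fin (k + 1) => ℝ) 0).symm
    rw [← hmp.lintegral_comp (by fun_prop)]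
    simp_rw [Fin.prod_univ_succ, MeasurableEquiv.piFinSuccAbove_symm_apply, Fin.insertNthEquiv,
      Fin.insertNth_zero', Equiv.coe_fn_mk, Fin.cons_succ, Fin.cons_zero]
    have hm : Measurable fun v : Fin k → ℝ => ∏ i, f i.succ (v i) :=
      Finset.measurable_prod _ fun i _ => (hf _).comp (measurable_pi_apply i)
    rw [← ih (fun i => f i.succ) (fun i => hf _), 
      ← lintegral_prod_mul (hf 0).aemeasurable hm.aemeasurable]
    rfl

instance isProbabilityMeasure_law (n : ℕ) (θ : Seq) : IsProbabilityMeasure (law n θ) := by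
  unfold law; infer_instance

theorem lintegral_law_prod (n : ℕ) (θ : Seq) (s : Finset ℕ) (f : ℕ → ℝ → ℝ≥0∞)
    (hf : ∀ i, Measurable (f i)) :
    ∫⁻ x, ∏ i ∈ s, f i (x i) ∂law n θ =
      ∏ i ∈ s, ∫⁻ y, f i y ∂gaussianReal (θ i) ((n : ℝ≥0)⁻¹) := by
  rw [law, lintegral_prod_eq_prod_lintegral_of_indepFun s (fun i (x : Seq) => f i (x i))
    (iIndepFun_infinitePi hf) (fun i => (hf i).comp (measurable_pi_apply i))]
  refine Finset.prod_congr rfl fun i _ => ?_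
  rw [← Measure.infinitePi_map_eval (fun i => gaussianReal (θ i) ((n : ℝ≥0)⁻¹)) i,
    lintegral_map (hf i) (measurable_pi_apply i)]

theorem lintegral_law_coord (n : ℕ) (θ : Seq) (i : ℕ) (f : ℝ → ℝ≥0∞) (hf : Measurable f) :
    ∫⁻ x, f (x i) ∂law n θ = ∫⁻ y, f y ∂gaussianReal (θ i) ((n : ℝ≥0)⁻¹) := by
  simpa using lintegral_law_prod n θ {i} (fun _ => f) (fun _ => hf)

theorem lintegral_law_exp (n : ℕ) (θ a : Seq) (s : Finset ℕ) (r : ℝ) :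
    ∫⁻ x, ENNReal.ofReal (Real.exp ((∑ i ∈ s, a i * x i) + r)) ∂law n θ =
      ENNReal.ofReal (Real.exp ((∑ i ∈ s, (θ i * a i + a i ^ 2 / (2 * n))) + r)) := by
  have h : ∀ x : Seq, ENNReal.ofReal (Real.exp ((∑ i ∈ s, a i * x i) + r)) =
      ENNReal.ofReal (Real.exp r) * ∏ i ∈ s, ENNReal.ofReal (Real.exp (a i * x i + 0)) := by
    intro x
    rw [← ENNReal.ofReal_prod_of_nonneg (fun _ _ => Real.exp_nonneg _),
      ← ENNReal.ofReal_mul (Real.exp_nonneg _), ← Real.exp_sum, ← Real.exp_add]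
    simp [add_comm]
  simp_rw [h]
  rw [lintegral_const_mul _ (by fun_prop),
    lintegral_law_prod n θ s (fun i y => ENNReal.ofReal (Real.exp (a i * y + 0)))
      (fun i => by fun_prop)]
  simp_rw [lintegral_exp_gaussianReal]
  rw [← ENNReal.ofReal_prod_of_nonneg (fun _ _ => Real.exp_nonneg _),
    ← ENNReal.ofReal_mul (Real.exp_nonneg _), ← Real.exp_sum, ← Real.exp_add, add_comm]
  have hs : ∀ i, θ i * a i + (((n : ℝ≥0)⁻¹ : ℝ≥0) : ℝ) * a i ^ 2 / 2 + 0 =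
      θ i * a i + a i ^ 2 / (2 * n) := by
    intro i
    push_cast
    -- For n = 0 the variance is the inverse of zero, which is zero, and so is the quotient on the
    -- right.
    by_cases hn : (n : ℝ) = 0
    · simp [hn]
    · field_simp
      ring
  simp_rw [hs]

theorem pow_four_le_exp (y : ℝ) : y ^ 4 ≤ 24 * (Real.exp y + Real.exp (-y)) := by
  have h : |y| ^ 4 / (Nat.factorial 4 : ℕ) ≤ Real.exp |y| :=
    Real.pow_div_factorial_le_exp _ (abs_nonneg y) 4
  have h2 : |y| ^ 4 = y ^ 4 := by rw [← abs_pow, abs_of_nonneg (by positivity)]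
  have h3 : Real.exp |y| ≤ Real.exp y + Real.exp (-y) := by
    rcases abs_cases y with ⟨h, _⟩ | ⟨h, _⟩ <;> rw [h]
    · linarith [Real.exp_pos (-y)]
    · linarith [Real.exp_pos y]
  rw [h2, div_le_iff₀ (by positivity)] at h
  norm_num [Nat.factorial] at h
  linarith

/-- A bound on the second and fourth moments of the standardized noise. -/
theorem lintegral_one_add_sq_le {n : ℕ} (hn : 0 < n) (ϑ : ℝ) :
    ∫⁻ x, ENNReal.ofReal ((n * (x - ϑ) ^ 2 + 1) ^ 2) ∂gaussianReal ϑ ((n : ℝ≥0)⁻¹) ≤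
      ENNReal.ofReal 200 := by
  have hn' : (0 : ℝ) < n := by positivity
  have hsq : √(n : ℝ) ^ 2 = n := Real.sq_sqrt hn'.le
  have hpt : ∀ x : ℝ, ((n : ℝ) * (x - ϑ) ^ 2 + 1) ^ 2 ≤
      2 + 48 * (Real.exp (√n * x + -(√n * ϑ)) + Real.exp (-√n * x + √n * ϑ)) := by
    intro x
    have h1 := pow_four_le_exp (√n * (x - ϑ))
    have h2 : (√(n : ℝ) * (x - ϑ)) ^ 4 = (n * (x - ϑ) ^ 2) ^ 2 := by
      rw [mul_pow, show √(n : ℝ) ^ 4 = (√(n : ℝ) ^ 2) ^ 2 by ring, hsq]; ring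
    rw [h2] at h1
    have h3 : √(n : ℝ) * x + -(√n * ϑ) = √n * (x - ϑ) := by ring
    have h4 : -√(n : ℝ) * x + √n * ϑ = -(√n * (x - ϑ)) := by ring
    rw [h3, h4]
    nlinarith [sq_nonneg ((n : ℝ) * (x - ϑ) ^ 2 - 1)]
  calc _ ≤ ∫⁻ x, (ENNReal.ofReal 2 + ENNReal.ofReal 48 *
          (ENNReal.ofReal (Real.exp (√n * x + -(√n * ϑ))) +
            ENNReal.ofReal (Real.exp (-√n * x + √n * ϑ)))) ∂gaussianReal ϑ ((n : ℝ≥0)⁻¹) := by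
        refine lintegral_mono fun x => ?_
        rw [← ENNReal.ofReal_add (by positivity) (by positivity),
          ← ENNReal.ofReal_mul (by positivity),
          ← ENNReal.ofReal_add (by positivity) (by positivity)]
        exact ENNReal.ofReal_le_ofReal (hpt x)
    _ = ENNReal.ofReal (2 + 48 * (Real.exp (1 / 2) + Real.exp (1 / 2))) := by
        rw [lintegral_add_left (by fun_prop), lintegral_const_mul _ (by fun_prop),
          lintegral_add_left (by fun_prop), lintegral_exp_gaussianReal, lintegral_exp_gaussianReal]
        have e1 : ϑ * √n + (((n : ℝ≥0)⁻¹ : ℝ≥0) : ℝ) * √(n : ℝ) ^ 2 / 2 + -(√n * ϑ) = 1 / 2 := by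
          rw [hsq]; push_cast; field_simp; ring
        have e2 : ϑ * -√n + (((n : ℝ≥0)⁻¹ : ℝ≥0) : ℝ) * (-√(n : ℝ)) ^ 2 / 2 + √n * ϑ = 1 / 2 := by
          rw [neg_sq, hsq]; push_cast; field_simp; ring
        rw [e1, e2, ENNReal.ofReal_add (by positivity) (by positivity),
          ENNReal.ofReal_mul (by positivity), ENNReal.ofReal_add (by positivity) (by positivity)]
        simp
    _ ≤ _ := by
        refine ENNReal.ofReal_le_ofReal ?_
        -- With exp(1/2) ≤ 2 the total is at most 2 + 48 · 4 = 194.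
        have h1 : Real.exp (1 / 2) ^ 2 = Real.exp 1 := by rw [← Real.exp_nat_mul]; norm_num
        have h2 := Real.exp_one_lt_d9
        have h3 : Real.exp (1 / 2) ≤ 2 := by nlinarith [Real.exp_pos (1 / 2)]
        linarith

/-! ### The evidence of a sieve component -/

/-- The prior density of the `i`-th coordinate. -/
def SievePrior.coordDensity (Pr : SievePrior) (i : ℕ) (t : ℝ) : ℝ≥0∞ :=
  ENNReal.ofReal (1 / Pr.scale i * Pr.density (t / Pr.scale i))

@[fun_prop]
theorem SievePrior.measurable_coordDensity (Pr : SievePrior) (i : ℕ) :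
    Measurable (Pr.coordDensity i) := by
  have := Pr.density_measurable
  unfold SievePrior.coordDensity
  fun_prop

theorem SievePrior.lintegral_coordDensity (Pr : SievePrior) (i : ℕ) :
    ∫⁻ t, Pr.coordDensity i t = 1 := by
  have hτ := Pr.scale_pos i
  have hm := Pr.density_measurable
  have h1 : ∀ t, Pr.coordDensity i t =
      ENNReal.ofReal (1 / Pr.scale i) * ENNReal.ofReal (Pr.density ((Pr.scale i)⁻¹ * t)) := by
    intro t
    rw [SievePrior.coordDensity, ENNReal.ofReal_mul (by positivity), div_eq_inv_mul t]
  simp_rw [h1]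
  rw [lintegral_const_mul _ (by fun_prop)]
  have hmap := Real.map_volume_mul_left (inv_ne_zero hτ.ne')
  have h2 : ∫⁻ t, ENNReal.ofReal (Pr.density ((Pr.scale i)⁻¹ * t)) =
      ∫⁻ t, ENNReal.ofReal (Pr.density t) ∂(volume.map ((Pr.scale i)⁻¹ * ·)) := by
    rw [lintegral_map (by fun_prop) (by fun_prop)]
  rw [h2, hmap, lintegral_smul_measure, Pr.density_lintegral, inv_inv, abs_of_pos hτ, smul_eq_mul,
    mul_one, ← ENNReal.ofReal_mul (by positivity)]
  field_simp
  simp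

/-- The marginal likelihood of the `i`-th coordinate. -/
def SievePrior.coordEvidence (Pr : SievePrior) (n i : ℕ) (y : ℝ) : ℝ≥0∞ :=
  relEvidence n (Pr.coordDensity i) 0 y

/-- The marginal likelihood of the `k`-dimensional component. -/
def SievePrior.evidence (Pr : SievePrior) (n k : ℕ) (x : Seq) : ℝ≥0∞ :=
  ∏ i ∈ Finset.range k, Pr.coordEvidence n i (x i)

theorem measurableEmbedding_extendZero (k : ℕ) : MeasurableEmbedding (extendZero k) := by
  refine Continuous.measurableEmbedding ?_ ?_
  · refine continuous_pi fun i => ?_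
    by_cases h : i < k
    · simpa [extendZero, h] using continuous_apply _
    · simpa [extendZero, h] using continuous_const
  · intro v w hvw
    funext i
    simpa [extendZero] using congrFun hvw i

/-- Since `extendZero` is a measurable embedding and the density is finite, no measurability of F is
required. This allows F to be the likelihood, whose series are finite sums only on the image of the
embedding. -/
theorem SievePrior.lintegral_component (Pr : SievePrior) (k : ℕ) (F : Seq → ℝ≥0∞) :
    ∫⁻ θ, F θ ∂Pr.component k =
      ∫⁻ v : Fin k → ℝ, (∏ i : Fin k, Pr.coordDensity i (v i)) * F (extendZero k v) := by
  rw [SievePrior.component, (measurableEmbedding_extendZero k).lintegral_map,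
    lintegral_withDensity_eq_lintegral_mul_non_measurable]
  · rfl
  · have : ∀ i : Fin k, Measurable fun v : Fin k → ℝ => Pr.coordDensity i (v i) := fun i =>
      (Pr.measurable_coordDensity i).comp (measurable_pi_apply i)
    exact Finset.measurable_prod _ fun i _ => this i
  · refine Eventually.of_forall fun v => ?_
    exact ENNReal.prod_lt_top fun i _ => ENNReal.ofReal_lt_top

theorem likelihood_extendZero (n k : ℕ) (v : Fin k → ℝ) (x : Seq) :
    likelihood n (extendZero k v) x =
      ∏ i : Fin k, ENNReal.ofReal (Real.exp (n * v i * x i - n / 2 * v i ^ 2)) := by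
  have h0 : ∀ i ∉ Finset.range k, extendZero k v i = 0 := fun i hi => by
    simp only [Finset.mem_range] at hi
    simp [extendZero, hi]
  rw [likelihood, tsum_eq_sum (s := Finset.range k) (fun i hi => by simp [h0 i hi]),
    tsum_eq_sum (s := Finset.range k) (fun i hi => by simp [h0 i hi]),
    Finset.sum_range, Finset.sum_range,
    ← ENNReal.ofReal_prod_of_nonneg (fun _ _ => Real.exp_nonneg _), ← Real.exp_sum,
    Finset.mul_sum, Finset.mul_sum, ← Finset.sum_sub_distrib]
  congr 2
  refine Finset.sum_congr rfl fun i _ => ?_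
  simp [extendZero, mul_assoc]

theorem SievePrior.lintegral_component_likelihood (Pr : SievePrior) (n k : ℕ) (x : Seq) :
    ∫⁻ θ, likelihood n θ x ∂Pr.component k = Pr.evidence n k x := by
  rw [Pr.lintegral_component, SievePrior.evidence, Finset.prod_range]
  simp_rw [likelihood_extendZero, ← Finset.prod_mul_distrib]
  rw [lintegral_fin_prod_eq_prod k (fun i t => Pr.coordDensity i t *
    ENNReal.ofReal (Real.exp (n * t * x i - n / 2 * t ^ 2))) (fun i => by fun_prop)]
  simp [SievePrior.coordEvidence, relEvidence]

/-- The posterior second moment of a coordinate, before normalization. -/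
theorem SievePrior.lintegral_component_likelihood_sq_le (Pr : SievePrior) (n k : ℕ) (x θ₀ : Seq)
    (r : ℕ → ℝ≥0∞)
    (hr : ∀ i, ∫⁻ t, ENNReal.ofReal ((t - θ₀ i) ^ 2) * (Pr.coordDensity i t *
      ENNReal.ofReal (Real.exp (n * t * x i - n / 2 * t ^ 2))) ≤ r i * Pr.coordEvidence n i (x i)) :
    ∫⁻ θ, likelihood n θ x * sqDist θ θ₀ ∂Pr.component k ≤
      Pr.evidence n k x * (∑ i ∈ Finset.range k, r i +
        ∑' i, if k ≤ i then ENNReal.ofReal (θ₀ i ^ 2) else 0) := by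
  set T : ℝ≥0∞ := ∑' i, if k ≤ i then ENNReal.ofReal (θ₀ i ^ 2) else 0 with hT
  have hsq : ∀ v : Fin k → ℝ, sqDist (extendZero k v) θ₀ =
      ∑ j : Fin k, ENNReal.ofReal ((v j - θ₀ j) ^ 2) + T := by
    intro v
    rw [sqDist, hT]
    have : ∀ i, ENNReal.ofReal ((extendZero k v i - θ₀ i) ^ 2) =
        (if i < k then ENNReal.ofReal ((extendZero k v i - θ₀ i) ^ 2) else 0) +
          if k ≤ i then ENNReal.ofReal (θ₀ i ^ 2) else 0 := by
      intro i
      by_cases h : i < k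
      · simp [h, not_le.2 h]
      · simp [h, not_lt.1 h, extendZero]
    rw [tsum_congr this, ENNReal.tsum_add, tsum_eq_sum (s := Finset.range k)
      (fun i hi => by simp at hi; simp [not_lt.2 hi]), Finset.sum_range]
    congr 1
    exact Finset.sum_congr rfl fun i _ => by simp [extendZero]
  obtain ⟨f, hf⟩ : ∃ f : Fin k → ℝ → ℝ≥0∞, ∀ i t, f i t = Pr.coordDensity i t *
    ENNReal.ofReal (Real.exp (n * t * x i - n / 2 * t ^ 2)) := ⟨_, fun _ _ => rfl⟩
  have hfm : ∀ i, Measurable (f i) := fun i => by rw [funext (hf i)]; fun_prop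
  have hfe : ∀ i : Fin k, ∫⁻ t, f i t = Pr.coordEvidence n i (x i) := fun i => by
    simp [hf, SievePrior.coordEvidence, relEvidence]
  have hE : Pr.evidence n k x = ∏ i : Fin k, Pr.coordEvidence n i (x i) := by
    rw [SievePrior.evidence, Finset.prod_range]
  have hprodm : Measurable fun v : Fin k → ℝ => ∏ i, f i (v i) :=
    Finset.measurable_prod _ fun i _ => (hfm i).comp (measurable_pi_apply i)
  have hint : ∫⁻ v : Fin k → ℝ, ∏ i, f i (v i) = Pr.evidence n k x := by
    rw [lintegral_fin_prod_eq_prod k f hfm, hE]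
    exact Finset.prod_congr rfl fun i _ => hfe i
  have hj : ∀ j : Fin k, ∫⁻ v : Fin k → ℝ, ENNReal.ofReal ((v j - θ₀ j) ^ 2) * ∏ i, f i (v i) ≤
      r j * Pr.evidence n k x := by
    intro j
    -- The squared error is moved into the factor j, so that the integrand is still a product over
    -- coordinates.
    have h1 : ∀ v : Fin k → ℝ, ENNReal.ofReal ((v j - θ₀ j) ^ 2) * ∏ i, f i (v i) =
        ∏ i, (if i = j then ENNReal.ofReal ((v i - θ₀ i) ^ 2) else 1) * f i (v i) := by
      intro v
      rw [Finset.prod_mul_distrib, Finset.prod_ite_eq' Finset.univ j]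
      simp
    simp_rw [h1]
    rw [lintegral_fin_prod_eq_prod k (fun i t =>
      (if i = j then ENNReal.ofReal ((t - θ₀ i) ^ 2) else 1) * f i t)
      (fun i => by have := hfm i; split_ifs <;> fun_prop)]
    calc _ ≤ ∏ i : Fin k, (if i = j then r i else 1) * Pr.coordEvidence n i (x i) := by
          refine Finset.prod_le_prod' fun i _ => ?_
          split_ifs with h
          · simpa only [hf] using hr i
          · simpa using (hfe i).le
      _ = _ := by
          rw [Finset.prod_mul_distrib, Finset.prod_ite_eq' Finset.univ j, hE]
          simp
  rw [Pr.lintegral_component]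
  calc _ = ∫⁻ v : Fin k → ℝ, ((∑ j : Fin k, ENNReal.ofReal ((v j - θ₀ j) ^ 2) * ∏ i, f i (v i)) +
          T * ∏ i, f i (v i)) := by
        refine lintegral_congr fun v => ?_
        rw [likelihood_extendZero, hsq, ← mul_assoc, ← Finset.prod_mul_distrib, ← Finset.sum_mul]
        simp_rw [hf]
        ring
    _ = ∑ j : Fin k, (∫⁻ v : Fin k → ℝ, ENNReal.ofReal ((v j - θ₀ j) ^ 2) * ∏ i, f i (v i)) +
          T * Pr.evidence n k x := by
        rw [lintegral_add_right _ (hprodm.const_mul _), lintegral_const_mul _ hprodm, hint,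
          lintegral_finsetSum]
        intro j _
        fun_prop
    _ ≤ ∑ j : Fin k, r j * Pr.evidence n k x + T * Pr.evidence n k x :=
        add_le_add_left (Finset.sum_le_sum fun j _ => hj j) _
    _ = _ := by
        rw [← Finset.sum_mul, ← add_mul, mul_comm, Finset.sum_range]

/-! ### The posterior distribution of the dimension -/

theorem SievePrior.aemeasurable_likelihood (Pr : SievePrior) (n : ℕ) (x : Seq) :
    AEMeasurable (fun θ => likelihood n θ x) Pr.measure := by
  refine aemeasurable_sum_measure_iff.2 fun k => AEMeasurable.smul_measure ?_ _
  rw [SievePrior.component, (measurableEmbedding_extendZero k).aemeasurable_map_iff]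
  refine Measurable.aemeasurable ?_
  have : ((fun θ => likelihood n θ x) ∘ extendZero k) = fun v : Fin k → ℝ =>
      ∏ i : Fin k, ENNReal.ofReal (Real.exp (n * v i * x i - n / 2 * v i ^ 2)) :=
    funext fun v => likelihood_extendZero n k v x
  rw [this]
  fun_prop

/-- The posterior probability of the dimension `k`. -/
def SievePrior.dimWeight (Pr : SievePrior) (n : ℕ) (x : Seq) (k : ℕ) : ℝ≥0∞ :=
  (∑' l, ENNReal.ofReal (Pr.weight l) * Pr.evidence n l x)⁻¹ *
    (ENNReal.ofReal (Pr.weight k) * Pr.evidence n k x)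

/-- Only an inequality, because the total evidence could be 0 or ∞, in which case all weights
vanish; equality is never needed. -/
theorem SievePrior.tsum_dimWeight_le_one (Pr : SievePrior) (n : ℕ) (x : Seq) :
    ∑' k, Pr.dimWeight n x k ≤ 1 := by
  unfold SievePrior.dimWeight
  rw [ENNReal.tsum_mul_left]
  exact ENNReal.inv_mul_le_one _

theorem SievePrior.dimWeight_le_one (Pr : SievePrior) (n : ℕ) (x : Seq) (k : ℕ) :
    Pr.dimWeight n x k ≤ 1 :=
  (ENNReal.le_tsum k).trans (Pr.tsum_dimWeight_le_one n x)

theorem SievePrior.lintegral_posterior_sqDist_le (Pr : SievePrior) (n : ℕ) (x θ₀ : Seq)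
    (r : ℕ → ℝ≥0∞)
    (hr : ∀ i, ∫⁻ t, ENNReal.ofReal ((t - θ₀ i) ^ 2) * (Pr.coordDensity i t *
      ENNReal.ofReal (Real.exp (n * t * x i - n / 2 * t ^ 2))) ≤ r i * Pr.coordEvidence n i (x i)) :
    ∫⁻ θ, sqDist θ θ₀ ∂Pr.posterior n x ≤
      ∑' k, Pr.dimWeight n x k * (∑ i ∈ Finset.range k, r i +
        ∑' i, if k ≤ i then ENNReal.ofReal (θ₀ i ^ 2) else 0) := by
  have hZ : ∫⁻ θ, likelihood n θ x ∂Pr.measure =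
      ∑' l, ENNReal.ofReal (Pr.weight l) * Pr.evidence n l x := by
    rw [SievePrior.measure, lintegral_sum_measure]
    simp_rw [lintegral_smul_measure, Pr.lintegral_component_likelihood, smul_eq_mul]
  have hm : Measurable fun θ : Seq => sqDist θ θ₀ := by
    unfold sqDist
    exact Measurable.tsum fun i => by fun_prop
  rw [SievePrior.posterior, lintegral_smul_measure, hZ, smul_eq_mul,
    lintegral_withDensity_eq_lintegral_mul₀ (Pr.aemeasurable_likelihood n x) hm.aemeasurable,
    SievePrior.measure, lintegral_sum_measure, ← ENNReal.tsum_mul_left]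
  refine ENNReal.tsum_le_tsum fun k => ?_
  rw [lintegral_smul_measure, smul_eq_mul, SievePrior.dimWeight, mul_assoc, mul_assoc]
  gcongr
  exact Pr.lintegral_component_likelihood_sq_le n k x θ₀ r hr

theorem inv_mul_le_inv_of_mul_le {A B Z : ℝ≥0∞} (h : A * B ≤ Z) : Z⁻¹ * A ≤ B⁻¹ := by
  rcases eq_or_ne B 0 with rfl | hB
  · simp
  rcases eq_or_ne B ∞ with rfl | hB'
  · rcases eq_or_ne A 0 with rfl | hA
    · simp
    · rw [ENNReal.mul_top hA, top_le_iff] at h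
      simp [h]
  calc Z⁻¹ * A ≤ (A * B)⁻¹ * A := by gcongr
    _ = B⁻¹ * (A⁻¹ * A) := by
        rw [ENNReal.mul_inv (Or.inr hB') (Or.inr hB)]; ring
    _ ≤ B⁻¹ := mul_le_of_le_one_right' (ENNReal.inv_mul_le_one _)

theorem SievePrior.evidence_mul_prod (Pr : SievePrior) (n : ℕ) (x : Seq) {k l : ℕ} (h : k ≤ l) :
    Pr.evidence n k x * ∏ i ∈ Finset.Ico k l, Pr.coordEvidence n i (x i) = Pr.evidence n l x := by
  unfold SievePrior.evidence
  simp_rw [Finset.range_eq_Ico]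
  exact Finset.prod_Ico_consecutive _ (Nat.zero_le _) h

/-- The denominator is bounded below by its term J, and the evidence of the first k coordinates,
common to both dimensions, cancels. -/
theorem SievePrior.dimWeight_le_inv (Pr : SievePrior) (n : ℕ) (x : Seq) {k J : ℕ} (h : k ≤ J) :
    Pr.dimWeight n x k ≤ (ENNReal.ofReal (Pr.weight J) *
      ∏ i ∈ Finset.Ico k J, Pr.coordEvidence n i (x i))⁻¹ := by
  have hk : ENNReal.ofReal (Pr.weight k) ≤ 1 := by
    rw [ENNReal.ofReal_le_one, ← Pr.weight_hasSum.tsum_eq]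
    exact Pr.weight_hasSum.summable.le_tsum k fun j _ => Pr.weight_nonneg j
  refine le_trans ?_ (inv_mul_le_inv_of_mul_le (A := Pr.evidence n k x)
    (Z := ∑' l, ENNReal.ofReal (Pr.weight l) * Pr.evidence n l x) ?_)
  · unfold SievePrior.dimWeight
    gcongr
    exact mul_le_of_le_one_left' hk
  · rw [mul_left_comm, Pr.evidence_mul_prod n x h]
    exact ENNReal.le_tsum (f := fun l => ENNReal.ofReal (Pr.weight l) * Pr.evidence n l x) J

theorem SievePrior.dimWeight_le_mul (Pr : SievePrior) (n : ℕ) (x : Seq) {k J : ℕ} (h : J ≤ k) :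
    Pr.dimWeight n x k ≤ (ENNReal.ofReal (Pr.weight J))⁻¹ * ENNReal.ofReal (Pr.weight k) *
      ∏ i ∈ Finset.Ico J k, Pr.coordEvidence n i (x i) := by
  have h1 : (∑' l, ENNReal.ofReal (Pr.weight l) * Pr.evidence n l x)⁻¹ * Pr.evidence n J x ≤
      (ENNReal.ofReal (Pr.weight J))⁻¹ := by
    refine inv_mul_le_inv_of_mul_le ?_
    rw [mul_comm]
    exact ENNReal.le_tsum (f := fun l => ENNReal.ofReal (Pr.weight l) * Pr.evidence n l x) J
  calc Pr.dimWeight n x k = (∑' l, ENNReal.ofReal (Pr.weight l) * Pr.evidence n l x)⁻¹ *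
        Pr.evidence n J x * (ENNReal.ofReal (Pr.weight k) *
          ∏ i ∈ Finset.Ico J k, Pr.coordEvidence n i (x i)) := by
        rw [SievePrior.dimWeight, ← Pr.evidence_mul_prod n x h]; ring
    _ ≤ (ENNReal.ofReal (Pr.weight J))⁻¹ * (ENNReal.ofReal (Pr.weight k) *
          ∏ i ∈ Finset.Ico J k, Pr.coordEvidence n i (x i)) := by gcongr
    _ = _ := by ring

theorem SievePrior.coordEvidence_eq (Pr : SievePrior) (n i : ℕ) (ϑ y : ℝ) :
    Pr.coordEvidence n i y = ENNReal.ofReal (Real.exp (n * ϑ * y - n / 2 * ϑ ^ 2)) *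
      relEvidence n (Pr.coordDensity i) ϑ y :=
  relEvidence_zero (Pr.measurable_coordDensity i) ϑ y

/-! #### Dimensions that are too small -/

/-- Half the exponent in the bound on the posterior odds of the dimension `k ≤ J`. -/
def underBound (n k J : ℕ) (D : ℝ) (θ₀ x : Seq) : ℝ :=
  (∑ i ∈ Finset.Ico k J, (-(n * θ₀ i / 2)) * x i) +
    (D / 2 + n / 4 * ∑ i ∈ Finset.Ico k J, θ₀ i ^ 2)

/-- A probability bounded by exp(y) is also bounded by exp(y/2). The halving is essential: the
inverse likelihood ratio has expectation one under the true law, while its square root has the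
Hellinger affinity, which decays with the energy between k and J. -/
theorem SievePrior.dimWeight_le_underBound (Pr : SievePrior) {n k J : ℕ} (hkJ : k ≤ J)
    {D v : ℝ} {e : ℕ → ℝ} {θ₀ : Seq} (he0 : ∀ i, 0 ≤ e i)
    (he : ∀ i < J, ∀ y, ENNReal.ofReal (Real.exp (-e i)) ≤
      relEvidence n (Pr.coordDensity i) (θ₀ i) y)
    (hv : Real.exp (-v) ≤ Pr.weight J) (hD : v + ∑ i ∈ Finset.range J, e i ≤ D) (x : Seq) :
    Pr.dimWeight n x k ≤ ENNReal.ofReal (Real.exp (underBound n k J D θ₀ x)) := by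
  set y := 2 * underBound n k J D θ₀ x with hy
  have hsum : ∑ i ∈ Finset.Ico k J, e i ≤ ∑ i ∈ Finset.range J, e i := by
    rw [Finset.range_eq_Ico]
    exact Finset.sum_le_sum_of_subset_of_nonneg
      (Finset.Ico_subset_Ico_left (Nat.zero_le _)) fun i _ _ => he0 i
  have hyeq : y = D - ∑ i ∈ Finset.Ico k J, (n * θ₀ i * x i - n / 2 * θ₀ i ^ 2) := by
    rw [hy, underBound, Finset.sum_sub_distrib, ← Finset.mul_sum, mul_add, Finset.mul_sum]
    have : ∀ i, 2 * (-(n * θ₀ i / 2) * x i) = -(n * θ₀ i * x i) := fun i => by ring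
    simp_rw [this, Finset.sum_neg_distrib]
    ring
  have h1 : Pr.dimWeight n x k ≤ ENNReal.ofReal (Real.exp y) := by
    refine (Pr.dimWeight_le_inv n x hkJ).trans ?_
    rw [← neg_neg y, Real.exp_neg (-y), ENNReal.ofReal_inv_of_pos (Real.exp_pos _),
      ENNReal.inv_le_inv]
    calc ENNReal.ofReal (Real.exp (-y))
        ≤ ENNReal.ofReal (Real.exp (-v) * ∏ i ∈ Finset.Ico k J,
            (Real.exp (n * θ₀ i * x i - n / 2 * θ₀ i ^ 2) * Real.exp (-e i))) := by
          refine ENNReal.ofReal_le_ofReal ?_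
          simp_rw [← Real.exp_add, ← Real.exp_sum]
          rw [← Real.exp_add, Real.exp_le_exp, hyeq, Finset.sum_add_distrib,
            Finset.sum_neg_distrib]
          linarith
      _ ≤ _ := by
          rw [ENNReal.ofReal_mul (Real.exp_nonneg _),
            ENNReal.ofReal_prod_of_nonneg (fun _ _ => by positivity)]
          refine mul_le_mul' (ENNReal.ofReal_le_ofReal hv) (Finset.prod_le_prod' fun i hi => ?_)
          rw [Pr.coordEvidence_eq n i (θ₀ i), ENNReal.ofReal_mul (Real.exp_nonneg _)]
          exact mul_le_mul_right (he i (Finset.mem_Ico.1 hi).2 _) _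
  rcases le_total 0 y with h | h
  · refine (Pr.dimWeight_le_one n x k).trans ?_
    rw [ENNReal.one_le_ofReal, Real.one_le_exp_iff]
    linarith
  · refine h1.trans (ENNReal.ofReal_le_ofReal (Real.exp_le_exp.2 ?_))
    linarith

theorem lintegral_law_underBound {n : ℕ} (hn : 0 < n) (k J : ℕ) (D : ℝ) (θ₀ : Seq) :
    ∫⁻ x, ENNReal.ofReal (Real.exp (underBound n k J D θ₀ x)) ∂law n θ₀ =
      ENNReal.ofReal (Real.exp (D / 2 - n / 8 * ∑ i ∈ Finset.Ico k J, θ₀ i ^ 2)) := by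
  unfold underBound
  rw [lintegral_law_exp n θ₀ (fun i => -(n * θ₀ i / 2))]
  have hn' : (n : ℝ) ≠ 0 := by positivity
  have : ∀ i, θ₀ i * -(n * θ₀ i / 2) + (-(n * θ₀ i / 2)) ^ 2 / (2 * n) =
      -(3 * n / 8) * θ₀ i ^ 2 := by
    intro i
    field_simp
    ring
  simp_rw [this, ← Finset.mul_sum]
  congr 2
  ring

/-- Where the bias exceeds 16D/N by r/N, the exponent is -3D/2 - r/8. The term r/8 absorbs the
excess, and the remaining exp(-D) pays for the sum over the dimensions below J. -/
theorem sub_mul_exp_le {D S : ℝ} (hD : 0 ≤ D) {N : ℝ} (hN : 0 < N) :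
    ENNReal.ofReal (S - 16 * D / N) * ENNReal.ofReal (Real.exp (D / 2 - N / 8 * S)) ≤
      ENNReal.ofReal (8 / N * Real.exp (-D)) := by
  rcases le_total S (16 * D / N) with h | h
  · rw [ENNReal.ofReal_of_nonpos (by linarith), zero_mul]
    exact zero_le
  · rw [← ENNReal.ofReal_mul (by linarith)]
    refine ENNReal.ofReal_le_ofReal ?_
    set r := N * S - 16 * D with hr
    have hr' : S - 16 * D / N = r / N := by rw [hr]; field_simp
    have hr0 : 0 ≤ r := by
      rw [div_le_iff₀ hN] at h
      rw [hr]; linarith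
    have h1 : r * Real.exp (-(r / 8)) ≤ 8 := by
      rw [Real.exp_neg, ← div_eq_mul_inv, div_le_iff₀ (Real.exp_pos _)]
      linarith [Real.add_one_le_exp (r / 8)]
    calc (S - 16 * D / N) * Real.exp (D / 2 - N / 8 * S)
        ≤ r / N * Real.exp (-(r / 8) + -D) := by
          rw [hr']
          gcongr
          rw [hr]; linarith
      _ = r * Real.exp (-(r / 8)) / N * Real.exp (-D) := by rw [Real.exp_add]; ring
      _ ≤ _ := by gcongr

/-! #### Dimensions that are too large -/

/-- A bound on the posterior probability of the dimension `k ≥ J`. -/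
def SievePrior.overBound (Pr : SievePrior) (n J k : ℕ) (θ₀ x : Seq) : ℝ≥0∞ :=
  ∏ i ∈ Finset.Ico J k, relEvidence n (Pr.coordDensity i) (θ₀ i) (x i) +
    ENNReal.ofReal (Real.exp ((∑ i ∈ Finset.Ico J k, (n * θ₀ i) * x i) +
      (-(n / 2 * ∑ i ∈ Finset.Ico J k, θ₀ i ^ 2))))

theorem min_one_mul_le (a b : ℝ≥0∞) : min 1 (a * b) ≤ a + b := by
  rcases le_total 1 b with h | h
  · exact (min_le_left _ _).trans (h.trans le_add_self)
  · exact (min_le_right _ _).trans ((mul_le_of_le_one_right' h).trans le_self_add)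

/-- The odds against J are the prior odds, the relative evidence and a likelihood ratio multiplied
together. The last two are dependent and the expectation of their product may be infinite for a
heavy-tailed prior density. Splitting the prior odds as s · s and using `min_one_mul_le` leaves a
sum of two terms with explicit expectations. -/
theorem SievePrior.dimWeight_le_overBound (Pr : SievePrior) {n J k : ℕ} (hJk : J ≤ k)
    {s : ℝ} (hs : 0 ≤ s) (hw : Pr.weight k ≤ s ^ 2 * Pr.weight J) (θ₀ x : Seq) :
    Pr.dimWeight n x k ≤ ENNReal.ofReal s * Pr.overBound n J k θ₀ x := by
  have hω : (ENNReal.ofReal (Pr.weight J))⁻¹ * ENNReal.ofReal (Pr.weight k) ≤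
      ENNReal.ofReal s * ENNReal.ofReal s := by
    calc _ ≤ (ENNReal.ofReal (Pr.weight J))⁻¹ * ENNReal.ofReal (s ^ 2 * Pr.weight J) := by gcongr
      _ = ENNReal.ofReal (s ^ 2) *
          ((ENNReal.ofReal (Pr.weight J))⁻¹ * ENNReal.ofReal (Pr.weight J)) := by
          rw [ENNReal.ofReal_mul (sq_nonneg s)]; ring
      _ ≤ ENNReal.ofReal (s ^ 2) := mul_le_of_le_one_right' (ENNReal.inv_mul_le_one _)
      _ = _ := by rw [sq, ENNReal.ofReal_mul hs]
  have hP : ∏ i ∈ Finset.Ico J k, ENNReal.ofReal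
      (Real.exp (n * θ₀ i * x i - n / 2 * θ₀ i ^ 2)) =
      ENNReal.ofReal (Real.exp ((∑ i ∈ Finset.Ico J k, (n * θ₀ i) * x i) +
        (-(n / 2 * ∑ i ∈ Finset.Ico J k, θ₀ i ^ 2)))) := by
    rw [← ENNReal.ofReal_prod_of_nonneg (fun _ _ => Real.exp_nonneg _), ← Real.exp_sum,
      Finset.sum_sub_distrib, ← Finset.mul_sum, sub_eq_add_neg]
  rw [SievePrior.overBound, mul_add, ← hP]
  refine le_trans (le_min (Pr.dimWeight_le_one n x k) ?_) (min_one_mul_le _ _)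
  refine (Pr.dimWeight_le_mul n x hJk).trans ?_
  rw [Finset.prod_congr rfl fun i _ => Pr.coordEvidence_eq n i (θ₀ i) (x i),
    Finset.prod_mul_distrib]
  calc _ ≤ ENNReal.ofReal s * ENNReal.ofReal s * _ := mul_le_mul_left hω _
    _ = _ := by ring

theorem SievePrior.measurable_overBound (Pr : SievePrior) (n J k : ℕ) (θ₀ : Seq) :
    Measurable (Pr.overBound n J k θ₀) := by
  unfold SievePrior.overBound
  refine Measurable.add (Finset.measurable_prod _ fun i _ => ?_) (by fun_prop)
  exact (measurable_relEvidence (Pr.measurable_coordDensity i) _).comp (measurable_pi_apply i)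

theorem SievePrior.lintegral_overBound (Pr : SievePrior) {n : ℕ} (hn : 0 < n) (J k : ℕ)
    (θ₀ : Seq) : ∫⁻ x, Pr.overBound n J k θ₀ x ∂law n θ₀ =
      ENNReal.ofReal (1 + Real.exp (n * ∑ i ∈ Finset.Ico J k, θ₀ i ^ 2)) := by
  unfold SievePrior.overBound
  have hm := fun i => measurable_relEvidence (N := n) (Pr.measurable_coordDensity i) (θ₀ i)
  rw [lintegral_add_right _ (by fun_prop), lintegral_law_exp n θ₀ (fun i => n * θ₀ i),
    lintegral_law_prod n θ₀ _ (fun i => relEvidence n (Pr.coordDensity i) (θ₀ i)) hm]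
  simp_rw [lintegral_relEvidence hn (Pr.measurable_coordDensity _) (Pr.lintegral_coordDensity _)]
  rw [Finset.prod_const_one, ENNReal.ofReal_add zero_le_one (Real.exp_nonneg _),
    ENNReal.ofReal_one]
  have hn' : (n : ℝ) ≠ 0 := by positivity
  have : ∀ i, θ₀ i * (n * θ₀ i) + (n * θ₀ i) ^ 2 / (2 * n) = (3 * n / 2) * θ₀ i ^ 2 := by
    intro i
    field_simp
    ring
  simp_rw [this, ← Finset.mul_sum]
  congr 3
  ring

/-! ### The bound on the posterior risk -/

/-- The squared bias `∑_{j > k} θ_j²`. -/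
def tailSq (θ : Seq) (k : ℕ) : ℝ≥0∞ := ∑' i, if k ≤ i then ENNReal.ofReal (θ i ^ 2) else 0

theorem tailSq_le_add (θ : Seq) (k J : ℕ) :
    tailSq θ k ≤ ENNReal.ofReal (∑ i ∈ Finset.Ico k J, θ i ^ 2) + tailSq θ J := by
  have h1 : ENNReal.ofReal (∑ i ∈ Finset.Ico k J, θ i ^ 2) =
      ∑' i, if i ∈ Finset.Ico k J then ENNReal.ofReal (θ i ^ 2) else 0 := by
    rw [ENNReal.ofReal_sum_of_nonneg fun _ _ => sq_nonneg _,
      tsum_eq_sum (s := Finset.Ico k J) (fun i hi => if_neg hi)]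
    exact Finset.sum_congr rfl fun i hi => (if_pos hi).symm
  rw [h1, tailSq, tailSq, ← ENNReal.tsum_add]
  refine ENNReal.tsum_le_tsum fun i => ?_
  by_cases hk : k ≤ i
  · by_cases hJ : J ≤ i
    · simp [hk, hJ]
    · simp [hk, not_le.1 hJ]
  · simp [hk]

theorem ofReal_sum_Ico_le_tailSq (θ : Seq) (J k : ℕ) :
    ENNReal.ofReal (∑ i ∈ Finset.Ico J k, θ i ^ 2) ≤ tailSq θ J := by
  rw [ENNReal.ofReal_sum_of_nonneg fun _ _ => sq_nonneg _, tailSq]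
  refine le_trans (Finset.sum_le_sum fun i hi => ?_) (ENNReal.sum_le_tsum (Finset.Ico J k))
  rw [if_pos (Finset.mem_Ico.1 hi).1]

/-- The variable part of the bound on the loss in one coordinate. -/
def coordLoss (n : ℕ) (B : ℝ) (θ₀ x : Seq) (i : ℕ) : ℝ≥0∞ :=
  ENNReal.ofReal (64 * (x i - θ₀ i) ^ 2 + B / n)

/-- Beyond J the bound on the loss may contain θ₀²; those terms add up to a multiple of the bias at
J, whatever k is. Only the noise part still grows with k. -/
theorem sum_loss_le {n J k : ℕ} {B : ℝ} {r : ℕ → ℝ} {θ₀ : Seq} (hB : 0 ≤ B)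
    (hr0 : ∀ i, 0 ≤ r i) (hrJ : ∀ i, J ≤ i → r i ≤ B * (1 / n + θ₀ i ^ 2)) (x : Seq) :
    ∑ i ∈ Finset.range k, ENNReal.ofReal (64 * (x i - θ₀ i) ^ 2 + r i) ≤
      ∑ i ∈ Finset.range k, coordLoss n B θ₀ x i +
        (ENNReal.ofReal (∑ i ∈ Finset.range J, r i) + ENNReal.ofReal B * tailSq θ₀ J) := by
  set f : ℕ → ℝ≥0∞ := fun i => (if i ∈ Finset.range J then ENNReal.ofReal (r i) else 0) +
    ENNReal.ofReal B * if J ≤ i then ENNReal.ofReal (θ₀ i ^ 2) else 0 with hf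
  have h1 : ENNReal.ofReal (∑ i ∈ Finset.range J, r i) + ENNReal.ofReal B * tailSq θ₀ J =
      ∑' i, f i := by
    rw [hf, ENNReal.tsum_add, ENNReal.tsum_mul_left, tailSq,
      tsum_eq_sum (s := Finset.range J) (fun i hi => if_neg hi),
      ENNReal.ofReal_sum_of_nonneg fun i _ => hr0 i]
    congr 1
    exact Finset.sum_congr rfl fun i hi => (if_pos hi).symm
  rw [h1]
  refine le_trans ?_ (add_le_add_right (ENNReal.sum_le_tsum (Finset.range k)) _)
  rw [← Finset.sum_add_distrib]
  refine Finset.sum_le_sum fun i _ => ?_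
  rw [hf, coordLoss]
  by_cases hJ : J ≤ i
  · have h2 := hrJ i hJ
    simp only [Finset.mem_range, not_lt.2 hJ, if_false, hJ, if_true, zero_add]
    rw [← ENNReal.ofReal_mul hB, ← ENNReal.ofReal_add (by positivity) (by positivity)]
    refine ENNReal.ofReal_le_ofReal ?_
    have : B * (1 / n + θ₀ i ^ 2) = B / n + B * θ₀ i ^ 2 := by ring
    linarith
  · simp only [Finset.mem_range, not_le.1 hJ, if_true, hJ, if_false, mul_zero, add_zero]
    have h0 := hr0 i
    rw [← ENNReal.ofReal_add (by positivity) h0]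
    refine ENNReal.ofReal_le_ofReal ?_
    have : 0 ≤ B / n := by positivity
    linarith

theorem coordLoss_le {n : ℕ} (hn : 0 < n) {B : ℝ} (hB : 0 ≤ B) (θ₀ x : Seq) (i : ℕ) :
    coordLoss n B θ₀ x i ≤
      ENNReal.ofReal ((64 + B) / n) * ENNReal.ofReal (n * (x i - θ₀ i) ^ 2 + 1) := by
  have hn' : (0 : ℝ) < n := by positivity
  rw [coordLoss, ← ENNReal.ofReal_mul (by positivity)]
  refine ENNReal.ofReal_le_ofReal ?_
  have : (64 + B) / n * (n * (x i - θ₀ i) ^ 2 + 1) =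
      64 * (x i - θ₀ i) ^ 2 + B / n + (B * (x i - θ₀ i) ^ 2 + 64 / n) := by
    field_simp
    ring
  rw [this]
  have : 0 ≤ B * (x i - θ₀ i) ^ 2 + 64 / n := by positivity
  linarith

theorem ofReal_le_ofReal_sq {y : ℝ} (hy : 0 ≤ y) :
    ENNReal.ofReal (y + 1) ≤ ENNReal.ofReal ((y + 1) ^ 2) :=
  ENNReal.ofReal_le_ofReal (by nlinarith)

/-- A weighted arithmetic-geometric mean inequality. -/
theorem mul_le_exp_add {p : ℝ≥0∞} (hp : p ≤ 1) {z : ℝ} (hz : 0 ≤ z) (s : ℝ) :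
    p * ENNReal.ofReal z ≤ ENNReal.ofReal (Real.exp s) * p +
      ENNReal.ofReal (Real.exp (-s)) * ENNReal.ofReal (z ^ 2) := by
  have hz2 : ENNReal.ofReal (Real.exp (-s)) * ENNReal.ofReal (z ^ 2) =
      ENNReal.ofReal (Real.exp (-s) * z ^ 2) := by
    rw [ENNReal.ofReal_mul (Real.exp_nonneg _)]
  -- Either z ≤ exp(s), or z ≤ exp(-s) z².
  rcases le_total z (Real.exp s) with h | h
  · refine le_trans ?_ le_self_add
    rw [mul_comm]
    gcongr
  · refine le_trans ?_ le_add_self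
    rw [hz2]
    refine (mul_le_of_le_one_left' hp).trans (ENNReal.ofReal_le_ofReal ?_)
    rw [Real.exp_neg, sq, ← mul_assoc]
    refine le_mul_of_one_le_left hz ?_
    rw [inv_mul_eq_div, one_le_div (Real.exp_pos s)]
    exact h

theorem lintegral_law_one_add_sq_le {n : ℕ} (hn : 0 < n) (θ₀ : Seq) (i : ℕ) :
    ∫⁻ x, ENNReal.ofReal ((n * (x i - θ₀ i) ^ 2 + 1) ^ 2) ∂law n θ₀ ≤ ENNReal.ofReal 200 := by
  rw [lintegral_law_coord n θ₀ i (fun y => ENNReal.ofReal ((n * (y - θ₀ i) ^ 2 + 1) ^ 2))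
    (by fun_prop)]
  exact lintegral_one_add_sq_le hn (θ₀ i)

theorem lintegral_law_coordLoss_le {n : ℕ} (hn : 0 < n) {B : ℝ} (hB : 0 ≤ B) (θ₀ : Seq) (i : ℕ) :
    ∫⁻ x, coordLoss n B θ₀ x i ∂law n θ₀ ≤ ENNReal.ofReal ((64 + B) / n * 200) := by
  calc _ ≤ ∫⁻ x, ENNReal.ofReal ((64 + B) / n) *
          ENNReal.ofReal ((n * (x i - θ₀ i) ^ 2 + 1) ^ 2) ∂law n θ₀ :=
        lintegral_mono fun x => (coordLoss_le hn hB θ₀ x i).trans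
          (mul_le_mul_right (ofReal_le_ofReal_sq (by positivity)) _)
    _ ≤ _ := by
        rw [lintegral_const_mul _ (by fun_prop), ENNReal.ofReal_mul (by positivity)]
        exact mul_le_mul_right (lintegral_law_one_add_sq_le hn θ₀ i) _

/-- A bound on the contribution of the coordinate `i` in a dimension `k` that is too large. -/
def SievePrior.overLoss (Pr : SievePrior) (n J : ℕ) (B b v : ℝ) (θ₀ x : Seq) (k i : ℕ) : ℝ≥0∞ :=
  ENNReal.ofReal ((64 + B) / n) * (ENNReal.ofReal (Real.exp (b / 8 * k)) *
    (ENNReal.ofReal (Real.exp (-(b / 2 * k) + v / 2)) * Pr.overBound n J k θ₀ x) +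
      ENNReal.ofReal (Real.exp (-(b / 8 * k))) *
        ENNReal.ofReal ((n * (x i - θ₀ i) ^ 2 + 1) ^ 2))

theorem SievePrior.measurable_overLoss (Pr : SievePrior) (n J : ℕ) (B b v : ℝ) (θ₀ : Seq)
    (k i : ℕ) : Measurable fun x => Pr.overLoss n J B b v θ₀ x k i := by
  have := Pr.measurable_overBound n J k θ₀
  unfold SievePrior.overLoss
  fun_prop

/-- The weight and the noise depend on the same observation. `mul_le_exp_add` separates them at the
price of a factor exp(bk/8), which the decay exp(-bk/2) of the weight bound can afford. -/
theorem SievePrior.dimWeight_mul_coordLoss_le (Pr : SievePrior) {n J k : ℕ} (hn : 0 < n)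
    (hJk : J ≤ k) {B b v : ℝ} (hB : 0 ≤ B) (hv : Real.exp (-v) ≤ Pr.weight J)
    (hw : Pr.weight k ≤ Real.exp (-b * k)) (θ₀ x : Seq) (i : ℕ) :
    Pr.dimWeight n x k * coordLoss n B θ₀ x i ≤ Pr.overLoss n J B b v θ₀ x k i := by
  have hs : Pr.weight k ≤ Real.exp (-(b / 2 * k) + v / 2) ^ 2 * Pr.weight J := by
    calc Pr.weight k ≤ Real.exp (-b * k) := hw
      _ = Real.exp (-(b / 2 * k) + v / 2) ^ 2 * Real.exp (-v) := by
          rw [← Real.exp_nat_mul, ← Real.exp_add]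
          congr 1
          push_cast
          ring
      _ ≤ _ := by gcongr
  have hp := Pr.dimWeight_le_overBound (n := n) hJk (Real.exp_nonneg _) hs θ₀ x
  calc _ ≤ Pr.dimWeight n x k * (ENNReal.ofReal ((64 + B) / n) *
          ENNReal.ofReal (n * (x i - θ₀ i) ^ 2 + 1)) := by
        gcongr; exact coordLoss_le hn hB θ₀ x i
    _ = ENNReal.ofReal ((64 + B) / n) *
          (Pr.dimWeight n x k * ENNReal.ofReal (n * (x i - θ₀ i) ^ 2 + 1)) := by ring
    _ ≤ ENNReal.ofReal ((64 + B) / n) * _ := mul_le_mul_right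
        (mul_le_exp_add (Pr.dimWeight_le_one n x k) (by positivity) (b / 8 * k)) _
    _ ≤ _ := by
        unfold SievePrior.overLoss
        gcongr

theorem SievePrior.lintegral_overLoss_le (Pr : SievePrior) {n J k : ℕ} (hn : 0 < n)
    {A B b v : ℝ} (hA : 0 ≤ A) (hB : 0 ≤ B) {θ₀ : Seq}
    (htail : tailSq θ₀ J ≤ ENNReal.ofReal (A / n)) (hk : v / 2 + A ≤ b / 4 * k) (i : ℕ) :
    ∫⁻ x, Pr.overLoss n J B b v θ₀ x k i ∂law n θ₀ ≤
      ENNReal.ofReal ((64 + B) / n * (202 * Real.exp (-(b / 8 * k)))) := by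
  have hn' : (0 : ℝ) < n := by positivity
  have hm := Pr.measurable_overBound n J k θ₀
  have hS : n * ∑ i ∈ Finset.Ico J k, θ₀ i ^ 2 ≤ A := by
    have h1 := (ENNReal.ofReal_le_ofReal_iff (by positivity)).1
      ((ofReal_sum_Ico_le_tailSq θ₀ J k).trans htail)
    rw [le_div_iff₀ hn'] at h1
    linarith
  have hre : Real.exp (b / 8 * k) * (Real.exp (-(b / 2 * k) + v / 2) *
      (1 + Real.exp (n * ∑ i ∈ Finset.Ico J k, θ₀ i ^ 2))) ≤ 2 * Real.exp (-(b / 8 * k)) := by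
    have h1 : 1 + Real.exp (n * ∑ i ∈ Finset.Ico J k, θ₀ i ^ 2) ≤ 2 * Real.exp A := by
      have h2 := Real.one_le_exp hA
      have h3 := Real.exp_le_exp.2 hS
      linarith
    calc _ ≤ Real.exp (b / 8 * k) * (Real.exp (-(b / 2 * k) + v / 2) * (2 * Real.exp A)) := by
          gcongr
      _ = 2 * Real.exp (b / 8 * k + (-(b / 2 * k) + v / 2) + A) := by
          rw [Real.exp_add _ A, Real.exp_add (b / 8 * k)]; ring
      -- The exponent is bk/8 - bk/2 + v/2 + A, and `hk` bounds v/2 + A by bk/4.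
      _ ≤ _ := by
          gcongr
          linarith
  unfold SievePrior.overLoss
  rw [lintegral_const_mul _ (by fun_prop), lintegral_add_right _ (by fun_prop),
    lintegral_const_mul _ (by fun_prop), lintegral_const_mul _ hm,
    lintegral_const_mul _ (by fun_prop), Pr.lintegral_overBound hn,
    ENNReal.ofReal_mul (by positivity), ← ENNReal.ofReal_mul (Real.exp_nonneg _),
    ← ENNReal.ofReal_mul (Real.exp_nonneg _)]
  gcongr
  calc _ ≤ ENNReal.ofReal (2 * Real.exp (-(b / 8 * k))) +
        ENNReal.ofReal (Real.exp (-(b / 8 * k))) * ENNReal.ofReal 200 :=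
        add_le_add (ENNReal.ofReal_le_ofReal hre)
          (mul_le_mul_right (lintegral_law_one_add_sq_le hn θ₀ i) _)
    _ = _ := by
        rw [← ENNReal.ofReal_mul (Real.exp_nonneg _),
          ← ENNReal.ofReal_add (by positivity) (by positivity)]
        congr 1
        ring

theorem summable_mul_exp_neg {b : ℝ} (hb : 0 < b) :
    Summable fun k : ℕ => (k : ℝ) * Real.exp (-(b / 8 * k)) := by
  have := Real.summable_pow_mul_exp_neg_nat_mul 1 (r := b / 8) (by positivity)
  refine this.congr fun k => ?_
  rw [pow_one, neg_mul]

theorem SievePrior.tsum_lintegral_overLoss_le (Pr : SievePrior) {n J K : ℕ} (hn : 0 < n)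
    {A B b v : ℝ} (hA : 0 ≤ A) (hB : 0 ≤ B) (hb : 0 < b) {θ₀ : Seq}
    (htail : tailSq θ₀ J ≤ ENNReal.ofReal (A / n)) (hK : v / 2 + A ≤ b / 4 * K) :
    ∑' k, ∫⁻ x, (if K ≤ k then ∑ i ∈ Finset.range k, Pr.overLoss n J B b v θ₀ x k i else 0)
      ∂law n θ₀ ≤
      ENNReal.ofReal ((64 + B) / n * 202 * ∑' k : ℕ, (k : ℝ) * Real.exp (-(b / 8 * k))) := by
  rw [← tsum_mul_left, ENNReal.ofReal_tsum_of_nonneg (fun k => by positivity)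
    ((summable_mul_exp_neg hb).mul_left _)]
  refine ENNReal.tsum_le_tsum fun k => ?_
  split_ifs with hk
  · rw [lintegral_finsetSum _ fun i _ => Pr.measurable_overLoss n J B b v θ₀ k i]
    have hk' : v / 2 + A ≤ b / 4 * k := hK.trans (by gcongr)
    refine (Finset.sum_le_card_nsmul _ _ _ fun i _ =>
      Pr.lintegral_overLoss_le hn hA hB htail hk' i).trans ?_
    rw [Finset.card_range, nsmul_eq_mul, ← ENNReal.ofReal_natCast,
      ← ENNReal.ofReal_mul (by positivity)]
    refine ENNReal.ofReal_le_ofReal (le_of_eq ?_)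
    ring
  · simp

/-- A bound for each fixed observation. The deterministic terms and the noise of the first K
coordinates are charged to total weight at most one; the last two sums correct for an excess of bias
below J and an excess of noise from K on. -/
theorem SievePrior.lintegral_posterior_sqDist_le_sum (Pr : SievePrior) {n J K : ℕ} (hn : 0 < n)
    {A B D v b : ℝ} {r e : ℕ → ℝ} {θ₀ : Seq} (hA : 0 ≤ A) (hB : 0 ≤ B) (hr0 : ∀ i, 0 ≤ r i)
    (hr : ∀ i y, ∫⁻ t, ENNReal.ofReal ((t - θ₀ i) ^ 2) * (Pr.coordDensity i t *
      ENNReal.ofReal (Real.exp (n * t * y - n / 2 * t ^ 2))) ≤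
      ENNReal.ofReal (64 * (y - θ₀ i) ^ 2 + r i) * Pr.coordEvidence n i y)
    (hrJ : ∀ i, J ≤ i → r i ≤ B * (1 / n + θ₀ i ^ 2)) (he0 : ∀ i, 0 ≤ e i)
    (he : ∀ i < J, ∀ y, ENNReal.ofReal (Real.exp (-e i)) ≤
      relEvidence n (Pr.coordDensity i) (θ₀ i) y)
    (hv : Real.exp (-v) ≤ Pr.weight J) (hD : v + ∑ i ∈ Finset.range J, e i ≤ D)
    (hw : ∀ k, K ≤ k → Pr.weight k ≤ Real.exp (-b * k)) (hJK : J ≤ K)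
    (htail : tailSq θ₀ J ≤ ENNReal.ofReal (A / n)) (x : Seq) :
    ∫⁻ θ, sqDist θ θ₀ ∂Pr.posterior n x ≤
      ENNReal.ofReal (∑ i ∈ Finset.range J, r i + (B + 1) * (A / n)) +
      ENNReal.ofReal (16 * D / n) + ∑ i ∈ Finset.range K, coordLoss n B θ₀ x i +
      ∑ k ∈ Finset.range J, ENNReal.ofReal (∑ i ∈ Finset.Ico k J, θ₀ i ^ 2 - 16 * D / n) *
        ENNReal.ofReal (Real.exp (underBound n k J D θ₀ x)) +
      ∑' k, if K ≤ k then ∑ i ∈ Finset.range k, Pr.overLoss n J B b v θ₀ x k i else 0 := by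
  set R : ℝ≥0∞ := ENNReal.ofReal (∑ i ∈ Finset.range J, r i + (B + 1) * (A / n)) with hR
  set W : ℝ≥0∞ := ∑ i ∈ Finset.range K, coordLoss n B θ₀ x i with hW
  set u : ℕ → ℝ≥0∞ := fun k => if k ∈ Finset.range J then
    ENNReal.ofReal (∑ i ∈ Finset.Ico k J, θ₀ i ^ 2 - 16 * D / n) *
      ENNReal.ofReal (Real.exp (underBound n k J D θ₀ x)) else 0 with hu
  set o : ℕ → ℝ≥0∞ := fun k =>
    if K ≤ k then ∑ i ∈ Finset.range k, Pr.overLoss n J B b v θ₀ x k i else 0 with ho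
  have hu_sum : ∑ k ∈ Finset.range J,
      ENNReal.ofReal (∑ i ∈ Finset.Ico k J, θ₀ i ^ 2 - 16 * D / n) *
        ENNReal.ofReal (Real.exp (underBound n k J D θ₀ x)) = ∑' k, u k := by
    rw [tsum_eq_sum (s := Finset.range J) (fun i hi => if_neg hi)]
    exact Finset.sum_congr rfl fun i hi => (if_pos hi).symm
  have hloss : ∀ k, ∑ i ∈ Finset.range k, ENNReal.ofReal (64 * (x i - θ₀ i) ^ 2 + r i) +
      tailSq θ₀ k ≤ R + ∑ i ∈ Finset.range k, coordLoss n B θ₀ x i +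
        ENNReal.ofReal (∑ i ∈ Finset.Ico k J, θ₀ i ^ 2) := by
    intro k
    have h1 : ENNReal.ofReal (∑ i ∈ Finset.range J, r i) + ENNReal.ofReal B * tailSq θ₀ J +
        tailSq θ₀ J ≤ R := by
      have hs : 0 ≤ ∑ i ∈ Finset.range J, r i := Finset.sum_nonneg fun i _ => hr0 i
      calc _ ≤ ENNReal.ofReal (∑ i ∈ Finset.range J, r i) +
            ENNReal.ofReal B * ENNReal.ofReal (A / n) + ENNReal.ofReal (A / n) := by gcongr
        _ = R := by
            rw [← ENNReal.ofReal_mul hB, ← ENNReal.ofReal_add hs (by positivity),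
              ← ENNReal.ofReal_add (by positivity) (by positivity), hR]
            congr 1
            ring
    calc _ ≤ (∑ i ∈ Finset.range k, coordLoss n B θ₀ x i +
          (ENNReal.ofReal (∑ i ∈ Finset.range J, r i) + ENNReal.ofReal B * tailSq θ₀ J)) +
          (ENNReal.ofReal (∑ i ∈ Finset.Ico k J, θ₀ i ^ 2) + tailSq θ₀ J) :=
          add_le_add (sum_loss_le hB hr0 hrJ x) (tailSq_le_add θ₀ k J)
      _ = (ENNReal.ofReal (∑ i ∈ Finset.range J, r i) + ENNReal.ofReal B * tailSq θ₀ J +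
          tailSq θ₀ J) + ∑ i ∈ Finset.range k, coordLoss n B θ₀ x i +
          ENNReal.ofReal (∑ i ∈ Finset.Ico k J, θ₀ i ^ 2) := by ring
      _ ≤ _ := by gcongr
  have hterm : ∀ k, Pr.dimWeight n x k *
      (∑ i ∈ Finset.range k, ENNReal.ofReal (64 * (x i - θ₀ i) ^ 2 + r i) + tailSq θ₀ k) ≤
      Pr.dimWeight n x k * (R + ENNReal.ofReal (16 * D / n) + W) + u k + o k := by
    intro k
    have hover : Pr.dimWeight n x k * ∑ i ∈ Finset.range k, coordLoss n B θ₀ x i ≤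
        Pr.dimWeight n x k * W + o k := by
      by_cases hk : K ≤ k
      · refine le_trans ?_ le_add_self
        simp only [ho, hk, if_true, Finset.mul_sum]
        exact Finset.sum_le_sum fun i _ =>
          Pr.dimWeight_mul_coordLoss_le hn (hJK.trans hk) hB hv (hw k hk) θ₀ x i
      · refine le_trans ?_ le_self_add
        gcongr
        exact Finset.sum_le_sum_of_subset (Finset.range_mono (not_le.1 hk).le)
    have hunder : Pr.dimWeight n x k * ENNReal.ofReal (∑ i ∈ Finset.Ico k J, θ₀ i ^ 2) ≤
        Pr.dimWeight n x k * ENNReal.ofReal (16 * D / n) + u k := by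
      by_cases hk : k < J
      · set S := ∑ i ∈ Finset.Ico k J, θ₀ i ^ 2
        simp only [hu, Finset.mem_range, hk, if_true]
        calc _ ≤ Pr.dimWeight n x k *
              (ENNReal.ofReal (16 * D / n) + ENNReal.ofReal (S - 16 * D / n)) := by
              gcongr
              calc ENNReal.ofReal S = ENNReal.ofReal (16 * D / n + (S - 16 * D / n)) := by
                    congr 1; ring
                _ ≤ _ := ENNReal.ofReal_add_le
          _ = Pr.dimWeight n x k * ENNReal.ofReal (16 * D / n) +
              ENNReal.ofReal (S - 16 * D / n) * Pr.dimWeight n x k := by ring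
          _ ≤ _ := by
              gcongr
              exact Pr.dimWeight_le_underBound hk.le he0 he hv hD x
      · simp [Finset.Ico_eq_empty_of_le (not_lt.1 hk)]
    calc _ ≤ Pr.dimWeight n x k * (R + ∑ i ∈ Finset.range k, coordLoss n B θ₀ x i +
          ENNReal.ofReal (∑ i ∈ Finset.Ico k J, θ₀ i ^ 2)) := mul_le_mul_right (hloss k) _
      _ = Pr.dimWeight n x k * R +
          Pr.dimWeight n x k * ∑ i ∈ Finset.range k, coordLoss n B θ₀ x i +
          Pr.dimWeight n x k * ENNReal.ofReal (∑ i ∈ Finset.Ico k J, θ₀ i ^ 2) := by ring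
      _ ≤ Pr.dimWeight n x k * R + (Pr.dimWeight n x k * W + o k) +
          (Pr.dimWeight n x k * ENNReal.ofReal (16 * D / n) + u k) := by gcongr
      _ = _ := by ring
  calc _ ≤ ∑' k, Pr.dimWeight n x k *
        (∑ i ∈ Finset.range k, ENNReal.ofReal (64 * (x i - θ₀ i) ^ 2 + r i) + tailSq θ₀ k) :=
        Pr.lintegral_posterior_sqDist_le n x θ₀ _ fun i => hr i (x i)
    _ ≤ ∑' k, (Pr.dimWeight n x k * (R + ENNReal.ofReal (16 * D / n) + W) + u k + o k) :=
        ENNReal.tsum_le_tsum hterm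
    _ = (∑' k, Pr.dimWeight n x k) * (R + ENNReal.ofReal (16 * D / n) + W) + ∑' k, u k +
        ∑' k, o k := by
        rw [ENNReal.tsum_add, ENNReal.tsum_add, ENNReal.tsum_mul_right]
    _ ≤ _ := by
        rw [hu_sum]
        gcongr
        exact mul_le_of_le_one_left' (Pr.tsum_dimWeight_le_one n x)

/-- Expectations are taken term by term. Each of the J small dimensions contributes at most 8
exp(-D) / n, and J ≤ D ≤ exp(D) bounds their sum by 8 / n. -/
theorem SievePrior.posteriorRisk_le (Pr : SievePrior) {n J K : ℕ} (hn : 0 < n)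
    {A B D v b : ℝ} {r e : ℕ → ℝ} {θ₀ : Seq} (hA : 0 ≤ A) (hB : 0 ≤ B) (hb : 0 < b)
    (hr0 : ∀ i, 0 ≤ r i)
    (hr : ∀ i y, ∫⁻ t, ENNReal.ofReal ((t - θ₀ i) ^ 2) * (Pr.coordDensity i t *
      ENNReal.ofReal (Real.exp (n * t * y - n / 2 * t ^ 2))) ≤
      ENNReal.ofReal (64 * (y - θ₀ i) ^ 2 + r i) * Pr.coordEvidence n i y)
    (hrJ : ∀ i, J ≤ i → r i ≤ B * (1 / n + θ₀ i ^ 2)) (he0 : ∀ i, 0 ≤ e i)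
    (he : ∀ i < J, ∀ y, ENNReal.ofReal (Real.exp (-e i)) ≤
      relEvidence n (Pr.coordDensity i) (θ₀ i) y)
    (hv : Real.exp (-v) ≤ Pr.weight J) (hD : v + ∑ i ∈ Finset.range J, e i ≤ D) (hJD : J ≤ D)
    (hw : ∀ k, K ≤ k → Pr.weight k ≤ Real.exp (-b * k)) (hJK : J ≤ K)
    (hK : v / 2 + A ≤ b / 4 * K) (htail : tailSq θ₀ J ≤ ENNReal.ofReal (A / n)) :
    Pr.posteriorRisk n θ₀ ≤ ENNReal.ofReal ((n * ∑ i ∈ Finset.range J, r i + (B + 1) * A +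
      16 * D + 200 * (64 + B) * K + 8 +
        202 * (64 + B) * ∑' k : ℕ, (k : ℝ) * Real.exp (-(b / 8 * k))) / n) := by
  have hn' : (0 : ℝ) < n := by positivity
  have hD0 : 0 ≤ D := (Nat.cast_nonneg J).trans hJD
  have hs : 0 ≤ ∑ i ∈ Finset.range J, r i := Finset.sum_nonneg fun i _ => hr0 i
  have hT : 0 ≤ ∑' k : ℕ, (k : ℝ) * Real.exp (-(b / 8 * k)) := tsum_nonneg fun k => by positivity
  have hmo : ∀ k, Measurable fun x : Seq =>
      if K ≤ k then ∑ i ∈ Finset.range k, Pr.overLoss n J B b v θ₀ x k i else 0 := by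
    intro k
    have := fun i => Pr.measurable_overLoss n J B b v θ₀ k i
    split_ifs <;> fun_prop
  have hml : ∀ i, Measurable fun x : Seq => coordLoss n B θ₀ x i := fun i => by
    unfold coordLoss; fun_prop
  have hmu : ∀ k, Measurable fun x : Seq =>
      ENNReal.ofReal (Real.exp (underBound n k J D θ₀ x)) := fun k => by
    unfold underBound; fun_prop
  have hloss : ∑ i ∈ Finset.range K, ∫⁻ x, coordLoss n B θ₀ x i ∂law n θ₀ ≤
      ENNReal.ofReal (K * ((64 + B) / n * 200)) := by
    refine (Finset.sum_le_card_nsmul _ _ _ fun i _ =>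
      lintegral_law_coordLoss_le hn hB θ₀ i).trans ?_
    rw [Finset.card_range, nsmul_eq_mul, ← ENNReal.ofReal_natCast,
      ← ENNReal.ofReal_mul (by positivity)]
  have hunder : ∑ k ∈ Finset.range J, ∫⁻ x,
      ENNReal.ofReal (∑ i ∈ Finset.Ico k J, θ₀ i ^ 2 - 16 * D / n) *
        ENNReal.ofReal (Real.exp (underBound n k J D θ₀ x)) ∂law n θ₀ ≤
      ENNReal.ofReal (8 / n) := by
    calc _ ≤ ∑ k ∈ Finset.range J, ENNReal.ofReal (8 / n * Real.exp (-D)) := by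
          refine Finset.sum_le_sum fun k _ => ?_
          rw [lintegral_const_mul _ (hmu k), lintegral_law_underBound hn]
          exact sub_mul_exp_le hD0 hn'
      _ = ENNReal.ofReal (8 / n * (J * Real.exp (-D))) := by
          rw [Finset.sum_const, Finset.card_range, nsmul_eq_mul, ← ENNReal.ofReal_natCast,
            ← ENNReal.ofReal_mul (by positivity)]
          congr 1
          ring
      _ ≤ _ := by
          refine ENNReal.ofReal_le_ofReal (mul_le_of_le_one_right (by positivity) ?_)
          rw [Real.exp_neg, ← div_eq_mul_inv, div_le_one (Real.exp_pos _)]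
          linarith [Real.add_one_le_exp D]
  calc Pr.posteriorRisk n θ₀ ≤ _ := lintegral_mono fun x =>
        Pr.lintegral_posterior_sqDist_le_sum hn hA hB hr0 hr hrJ he0 he hv hD hw hJK htail x
    _ = ENNReal.ofReal (∑ i ∈ Finset.range J, r i + (B + 1) * (A / n)) +
        ENNReal.ofReal (16 * D / n) + ∑ i ∈ Finset.range K, ∫⁻ x, coordLoss n B θ₀ x i ∂law n θ₀ +
        ∑ k ∈ Finset.range J, ∫⁻ x,
          ENNReal.ofReal (∑ i ∈ Finset.Ico k J, θ₀ i ^ 2 - 16 * D / n) *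
            ENNReal.ofReal (Real.exp (underBound n k J D θ₀ x)) ∂law n θ₀ +
        ∑' k, ∫⁻ x, (if K ≤ k then ∑ i ∈ Finset.range k, Pr.overLoss n J B b v θ₀ x k i else 0)
          ∂law n θ₀ := by
        rw [lintegral_add_right _ (Measurable.tsum hmo), lintegral_tsum fun k =>
          (hmo k).aemeasurable, lintegral_add_right _ (by fun_prop),
          lintegral_finsetSum _ fun k _ => (hmu k).const_mul _,
          lintegral_add_right _ (by fun_prop), lintegral_finsetSum _ fun i _ => hml i,
          lintegral_const, measure_univ, mul_one]
    _ ≤ ENNReal.ofReal (∑ i ∈ Finset.range J, r i + (B + 1) * (A / n)) +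
        ENNReal.ofReal (16 * D / n) + ENNReal.ofReal (K * ((64 + B) / n * 200)) +
        ENNReal.ofReal (8 / n) + ENNReal.ofReal ((64 + B) / n * 202 *
          ∑' k : ℕ, (k : ℝ) * Real.exp (-(b / 8 * k))) := by
        gcongr
        exact Pr.tsum_lintegral_overLoss_le hn hA hB hb htail hK
    _ = _ := by
        rw [← ENNReal.ofReal_add (by positivity) (by positivity),
          ← ENNReal.ofReal_add (by positivity) (by positivity),
          ← ENNReal.ofReal_add (by positivity) (by positivity),
          ← ENNReal.ofReal_add (by positivity) (by positivity)]
        congr 1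
        generalize ∑' k : ℕ, (k : ℝ) * Real.exp (-(b / 8 * k)) = T
        field_simp

/-! ### Consequences of the prior condition -/

theorem SievePrior.ofReal_le_coordDensity (Pr : SievePrior) (i : ℕ) {G₁ G₂ α : ℝ}
    (h : ∀ t : ℝ, G₁ * Real.exp (-G₂ * |t| ^ α) ≤ Pr.density t) (t : ℝ) :
    ENNReal.ofReal (1 / Pr.scale i * (G₁ * Real.exp (-G₂ * |t / Pr.scale i| ^ α))) ≤
      Pr.coordDensity i t := by
  have := Pr.scale_pos i
  refine ENNReal.ofReal_le_ofReal ?_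
  gcongr
  exact h _

theorem SievePrior.coordDensity_le_ofReal (Pr : SievePrior) (i : ℕ) {G₃ G₄ α : ℝ} (hG₃ : 0 < G₃)
    (hG₄ : 0 < G₄) (h : ∀ t : ℝ, Pr.density t ≤ G₃ * Real.exp (-G₄ * |t| ^ α)) (t : ℝ) :
    Pr.coordDensity i t ≤ ENNReal.ofReal (G₃ / Pr.scale i) := by
  have := Pr.scale_pos i
  refine ENNReal.ofReal_le_ofReal ?_
  rw [one_div, inv_mul_eq_div]
  gcongr
  refine (h _).trans (mul_le_of_le_one_right hG₃.le ?_)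
  rw [Real.exp_le_one_iff, neg_mul]
  have := Real.rpow_nonneg (abs_nonneg (t / Pr.scale i)) α
  nlinarith

/-- The constant in the bound on the posterior second moment of one coordinate. -/
def PriorConstants.moment (c : PriorConstants) : ℝ := momentConst c.G₁ c.G₂ c.G₃ c.α

theorem PriorConstants.moment_nonneg (c : PriorConstants) : 0 ≤ c.moment := by
  have h1 := c.G₁_pos
  have h2 := c.G₂_pos
  have h3 : (0 : ℝ) ≤ max 1 (4 * √Real.pi * c.G₃) := le_trans zero_le_one (le_max_left _ _)
  unfold PriorConstants.moment momentConst
  positivity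

section

variable {c : PriorConstants} {L : ℝ → ℝ} {Pr : SievePrior} {n J kn : ℕ} {θ₀ : Seq}

theorem PriorCondition.lintegral_sq_mul_le (hP : PriorCondition c L Pr n J kn θ₀) (hn : 0 < n)
    (i : ℕ) (ϑ y : ℝ) :
    ∫⁻ t, ENNReal.ofReal ((t - ϑ) ^ 2) * (Pr.coordDensity i t *
      ENNReal.ofReal (Real.exp (n * t * y - n / 2 * t ^ 2))) ≤
      ENNReal.ofReal (16 * (y - ϑ) ^ 2 + c.moment * (1 + |ϑ / Pr.scale i| ^ c.α) / n) *
        Pr.coordEvidence n i y := by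
  have hm := Pr.measurable_coordDensity i
  have h := WhiteNoise.lintegral_sq_mul_le (N := n) hm (by positivity) (Pr.scale_pos i)
    c.G₁_pos c.G₂_pos c.G₃_pos c.α_pos (Pr.lintegral_coordDensity i)
    (Pr.ofReal_le_coordDensity i hP.density_lower)
    (Pr.coordDensity_le_ofReal i c.G₃_pos c.G₄_pos hP.density_upper) ϑ y
  rw [Pr.coordEvidence_eq n i ϑ, mul_left_comm]
  refine le_trans (le_of_eq ?_) (mul_le_mul_right h _)
  rw [← lintegral_const_mul _ (by fun_prop)]
  refine lintegral_congr fun t => ?_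
  have : Real.exp (n * t * y - n / 2 * t ^ 2) = Real.exp (n * ϑ * y - n / 2 * ϑ ^ 2) *
      Real.exp (n * (t - ϑ) * (y - ϑ) - n / 2 * (t - ϑ) ^ 2) := by
    rw [← Real.exp_add]
    congr 1
    ring
  rw [this, ENNReal.ofReal_mul (Real.exp_nonneg _)]
  ring

/-- Beyond the cutoff there is no control of ϑ/τ. The second moment is therefore taken about 0,
where this ratio vanishes, and recentred at the price of ϑ², which the bias absorbs. -/
theorem PriorCondition.lintegral_sq_mul_le' (hP : PriorCondition c L Pr n J kn θ₀) (hn : 0 < n)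
    (i : ℕ) (ϑ y : ℝ) :
    ∫⁻ t, ENNReal.ofReal ((t - ϑ) ^ 2) * (Pr.coordDensity i t *
      ENNReal.ofReal (Real.exp (n * t * y - n / 2 * t ^ 2))) ≤
      ENNReal.ofReal (64 * (y - ϑ) ^ 2 + (66 + 2 * c.moment) * (1 / n + ϑ ^ 2)) *
        Pr.coordEvidence n i y := by
  have hm := Pr.measurable_coordDensity i
  have hc := c.moment_nonneg
  have h0 := hP.lintegral_sq_mul_le hn i 0 y
  have he : ∫⁻ t, Pr.coordDensity i t *
      ENNReal.ofReal (Real.exp (n * t * y - n / 2 * t ^ 2)) = Pr.coordEvidence n i y := by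
    simp [SievePrior.coordEvidence, relEvidence]
  simp only [sub_zero, zero_div, abs_zero, Real.zero_rpow c.α_pos.ne', add_zero, mul_one] at h0
  calc _ ≤ ∫⁻ t, (2 * (ENNReal.ofReal (t ^ 2) * (Pr.coordDensity i t *
          ENNReal.ofReal (Real.exp (n * t * y - n / 2 * t ^ 2)))) +
          ENNReal.ofReal (2 * ϑ ^ 2) * (Pr.coordDensity i t *
            ENNReal.ofReal (Real.exp (n * t * y - n / 2 * t ^ 2)))) := by
        refine lintegral_mono fun t => ?_
        rw [← mul_assoc 2, ← add_mul]
        gcongr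
        rw [← ENNReal.ofReal_ofNat 2, ← ENNReal.ofReal_mul (by norm_num),
          ← ENNReal.ofReal_add (by positivity) (by positivity)]
        refine ENNReal.ofReal_le_ofReal ?_
        nlinarith [sq_nonneg (t + ϑ)]
    _ ≤ 2 * (ENNReal.ofReal (16 * y ^ 2 + c.moment / n) * Pr.coordEvidence n i y) +
          ENNReal.ofReal (2 * ϑ ^ 2) * Pr.coordEvidence n i y := by
        rw [lintegral_add_left (by fun_prop), lintegral_const_mul _ (by fun_prop),
          lintegral_const_mul _ (by fun_prop), he]
        gcongr
    _ ≤ _ := by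
        rw [← mul_assoc, ← add_mul]
        gcongr
        rw [← ENNReal.ofReal_ofNat 2, ← ENNReal.ofReal_mul (by norm_num),
          ← ENNReal.ofReal_add (by positivity) (by positivity)]
        refine ENNReal.ofReal_le_ofReal ?_
        -- 66 = 64 + 2: the 2 comes from recentring, the 64 from 32 y² ≤ 64 (y - ϑ)² + 64 ϑ², whose
        -- defect is 32 (y - 2ϑ)².
        have h1 : (66 + 2 * c.moment) * (1 / n + ϑ ^ 2) =
          66 * ϑ ^ 2 + 2 * (c.moment / n) + (66 * (1 / n) + 2 * c.moment * ϑ ^ 2) := by ring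
        have h2 : 0 ≤ 66 * (1 / (n : ℝ)) + 2 * c.moment * ϑ ^ 2 := by positivity
        nlinarith [sq_nonneg (y - 2 * ϑ)]

/-- The constant in the lower bound on the relative evidence of one coordinate. -/
def PriorConstants.massBound (c : PriorConstants) : ℝ :=
  max 1 ((1 + c.τ₀) * Real.exp (1 / 2) / c.G₁)

/-- The scales are bounded above, so `massFactor` is at least of order 1/√n. Each coordinate thus
costs (log n)/2 in the exponent, which is one source of the logarithm in the rate. -/
theorem PriorCondition.relEvidence_ge (hP : PriorCondition c L Pr n J kn θ₀) (hn : 0 < n)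
    (i : ℕ) (ϑ y : ℝ) :
    ENNReal.ofReal (Real.exp (-(Real.log c.massBound + Real.log n / 2 +
      c.G₂ * 2 ^ c.α * (1 + |ϑ / Pr.scale i| ^ c.α)))) ≤
      relEvidence n (Pr.coordDensity i) ϑ y := by
  have hn' : (1 : ℝ) ≤ n := by exact_mod_cast hn
  have hn0 : (0 : ℝ) < n := by positivity
  have hG := c.G₁_pos
  have hτ := Pr.scale_pos i
  have hτ0 := c.τ₀_pos
  refine le_trans (ENNReal.ofReal_le_ofReal ?_) (WhiteNoise.relEvidence_ge (N := n) (by positivity)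
    (Pr.scale_pos i) c.G₁_pos c.G₂_pos c.α_pos (Pr.ofReal_le_coordDensity i hP.density_lower) ϑ y)
  have hE : 0 < c.massBound := lt_of_lt_of_le one_pos (le_max_left _ _)
  rw [neg_add, Real.exp_add]
  gcongr
  have hsq : Real.exp (Real.log n / 2) = √n := by
    rw [← Real.log_sqrt hn0.le, Real.exp_log (Real.sqrt_pos.2 hn0)]
  rw [Real.exp_neg, Real.exp_add, Real.exp_log hE, hsq]
  have hs1 : 1 ≤ √(n : ℝ) := Real.one_le_sqrt.2 hn'
  have hmass : 1 / (√n * (1 + c.τ₀)) ≤ massFactor n (Pr.scale i) := by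
    refine le_min ?_ ?_
    · rw [div_le_one (by positivity)]
      nlinarith
    · have := hP.scale_upper i
      gcongr
      linarith
  calc (c.massBound * √n)⁻¹ ≤ ((1 + c.τ₀) * Real.exp (1 / 2) / c.G₁ * √n)⁻¹ := by
        gcongr
        exact le_max_right _ _
    _ = c.G₁ * Real.exp (-(1 / 2)) * (1 / (√n * (1 + c.τ₀))) := by
        rw [Real.exp_neg]
        field_simp
    _ ≤ _ := by gcongr

theorem PriorCondition.sum_le (hP : PriorCondition c L Pr n J kn θ₀) (hlog : 1 ≤ Real.log n) :
    ∑ i ∈ Finset.range J, (1 + |θ₀ i / Pr.scale i| ^ c.α) ≤ (1 + c.C) * (J * Real.log n) := by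
  have h1 : ∀ i, |θ₀ i / Pr.scale i| ^ c.α = |θ₀ i| ^ c.α / Pr.scale i ^ c.α := fun i => by
    rw [abs_div, abs_of_pos (Pr.scale_pos i), Real.div_rpow (abs_nonneg _) (Pr.scale_pos i).le]
  simp_rw [h1]
  rw [Finset.sum_add_distrib, Finset.sum_const, Finset.card_range, nsmul_eq_mul, mul_one]
  have h2 : (J : ℝ) ≤ J * Real.log n := le_mul_of_one_le_right (Nat.cast_nonneg J) hlog
  linarith [hP.sum_bound]

end

theorem one_le_log_natCast {n : ℕ} (hn : 3 ≤ n) : 1 ≤ Real.log n := by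
  have hn' : (3 : ℝ) ≤ n := by exact_mod_cast hn
  rw [Real.le_log_iff_exp_le (by linarith)]
  linarith [Real.exp_one_lt_d9]

/-- A bound on the posterior risk in terms of the cutoff `J`. -/
theorem exists_posteriorRisk_le (c : PriorConstants) {b A₀ : ℝ} (hb : 0 < b) (hA₀ : 0 ≤ A₀)
    {K₀ : ℕ} (hK₀ : 1 ≤ K₀) :
    ∃ C : ℝ, 0 ≤ C ∧ ∀ (L : ℝ → ℝ) (Pr : SievePrior) (n J kn : ℕ) (θ₀ : Seq), 3 ≤ n → 1 ≤ J →
      PriorCondition c L Pr n J kn θ₀ → L J ≤ Real.log n →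
      (∀ k : ℕ, K₀ ≤ k → b ≤ c.b * L k) →
      tailSq θ₀ J ≤ ENNReal.ofReal (A₀ * (J * Real.log n) / n) →
      Pr.posteriorRisk n θ₀ ≤ ENNReal.ofReal (C * (J * Real.log n / n)) := by
  set q := c.G₂ * 2 ^ c.α with hq
  set B := 66 + 2 * c.moment with hB
  set E := Real.log c.massBound with hE
  -- D = dH dominates the prior cost aH of the dimension J and the evidence costs of J coordinates;
  -- the final 1 ensures J ≤ D.
  set d := c.a + (E + 1 / 2 + q * (1 + c.C)) + 1 with hd
  set κ := K₀ + 1 + (4 * (c.a / 2 + A₀) / b + 1) with hκ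
  set T := ∑' k : ℕ, (k : ℝ) * Real.exp (-(b / 8 * k)) with hT
  have ha := c.a_pos
  have hC := c.C_pos
  have hG₂ := c.G₂_pos
  have hmom := c.moment_nonneg
  have hE0 : 0 ≤ E := Real.log_nonneg (le_max_left _ _)
  have hT0 : 0 ≤ T := tsum_nonneg fun k => by positivity
  have hκ0 : 0 ≤ κ := by positivity
  have hd0 : 0 ≤ d := by positivity
  refine ⟨c.moment * (1 + c.C) + (B + 1) * A₀ + 16 * d + 200 * (64 + B) * κ + 8 +
    202 * (64 + B) * T, by positivity, ?_⟩
  intro L Pr n J kn θ₀ hn hJ hP hLJ hLk htail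
  have hn0 : 0 < n := by omega
  have hn' : (0 : ℝ) < n := by positivity
  have hlog := one_le_log_natCast hn
  have hJ' : (1 : ℝ) ≤ J := by exact_mod_cast hJ
  set H := J * Real.log n with hH
  have hJH : (J : ℝ) ≤ H := le_mul_of_one_le_right (by linarith) hlog
  have hH1 : 1 ≤ H := hJ'.trans hJH
  have hΛ := hP.sum_le hlog
  have hΛ0 : ∀ i, 0 ≤ 1 + |θ₀ i / Pr.scale i| ^ c.α := fun i => by positivity
  -- Centring at θ₀ below the cutoff, where the sum over θ₀/τ is controlled, and at 0 beyond it.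
  set r : ℕ → ℝ := fun i => if i < J then c.moment * (1 + |θ₀ i / Pr.scale i| ^ c.α) / n else
    B * (1 / n + θ₀ i ^ 2) with hr
  set e : ℕ → ℝ := fun i => E + Real.log n / 2 + q * (1 + |θ₀ i / Pr.scale i| ^ c.α) with he
  -- The three terms give, in turn, the exponential decay of the prior weights from K on, J ≤ K, and
  -- v/2 + A ≤ bK/4.
  set K := K₀ + J + ⌈4 * (c.a / 2 + A₀) / b * H⌉₊ with hK
  have hK1 : (K : ℝ) ≤ κ * H := by
    have h1 : (⌈4 * (c.a / 2 + A₀) / b * H⌉₊ : ℝ) ≤ 4 * (c.a / 2 + A₀) / b * H + 1 :=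
      (Nat.ceil_lt_add_one (by positivity)).le
    have h2 : (K₀ : ℝ) ≤ K₀ * H := le_mul_of_one_le_right (Nat.cast_nonneg _) hH1
    rw [hK, hκ]
    push_cast
    nlinarith
  have hK2 : c.a * H / 2 + A₀ * H ≤ b / 4 * K := by
    have h1 : 4 * (c.a / 2 + A₀) / b * H ≤ K := by
      refine (Nat.le_ceil _).trans ?_
      exact_mod_cast Nat.le_add_left _ _
    calc c.a * H / 2 + A₀ * H = b / 4 * (4 * (c.a / 2 + A₀) / b * H) := by field_simp
      _ ≤ _ := by gcongr
  have hr0 : ∀ i, 0 ≤ r i := fun i => by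
    have := hΛ0 i
    simp only [hr]
    split_ifs <;> positivity
  have hrisk := Pr.posteriorRisk_le (n := n) (J := J) (K := K) (A := A₀ * H) (B := B)
    (D := d * H) (v := c.a * H) (b := b) (r := r) (e := e) (θ₀ := θ₀) hn0 (by positivity)
    (by positivity) hb hr0 ?_ ?_ ?_ ?_ ?_ ?_ ?_ ?_ ?_ hK2 htail
  · refine hrisk.trans (ENNReal.ofReal_le_ofReal ?_)
    rw [← hT, mul_div_assoc']
    gcongr
    have h1 : n * ∑ i ∈ Finset.range J, r i ≤ c.moment * (1 + c.C) * H := by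
      have h2 : ∀ i ∈ Finset.range J, (n : ℝ) * r i =
          c.moment * (1 + |θ₀ i / Pr.scale i| ^ c.α) := fun i hi => by
        simp only [hr, Finset.mem_range.1 hi, if_true]
        field_simp
      rw [Finset.mul_sum, Finset.sum_congr rfl h2, ← Finset.mul_sum, mul_assoc]
      gcongr
    have h3 : 200 * (64 + B) * K ≤ 200 * (64 + B) * (κ * H) := by gcongr
    have h4 : 8 + 202 * (64 + B) * T ≤ (8 + 202 * (64 + B) * T) * H :=
      le_mul_of_one_le_right (by positivity) hH1
    linarith
  · intro i y
    simp only [hr]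
    split_ifs with hi
    · refine (hP.lintegral_sq_mul_le hn0 i (θ₀ i) y).trans ?_
      gcongr
      norm_num
    · exact hP.lintegral_sq_mul_le' hn0 i (θ₀ i) y
  · intro i hi
    simp [hr, not_lt.2 hi]
  · intro i
    have := hΛ0 i
    simp only [he]
    positivity
  · intro i _ y
    exact hP.relEvidence_ge hn0 i (θ₀ i) y
  · refine le_trans (Real.exp_le_exp.2 ?_) (hP.weight_lower J hJ)
    have := mul_le_mul_of_nonneg_left hLJ (mul_nonneg ha.le (Nat.cast_nonneg J))
    rw [hH]
    linarith
  · have h1 : ∑ i ∈ Finset.range J, e i ≤ (E + 1 / 2 + q * (1 + c.C)) * H := by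
      simp only [he, Finset.sum_add_distrib (f := fun _ => E + Real.log n / 2),
        ← Finset.mul_sum, Finset.sum_const, Finset.card_range, nsmul_eq_mul]
      have h2 : q * ∑ i ∈ Finset.range J, (1 + |θ₀ i / Pr.scale i| ^ c.α) ≤
          q * ((1 + c.C) * H) := by gcongr
      have h3 : E * J ≤ E * H := by gcongr
      have h4 : (J : ℝ) * (E + Real.log n / 2) = E * J + H / 2 := by rw [hH]; ring
      linarith
    rw [hd]
    linarith
  · have h1 : 1 * H ≤ d * H := by
      gcongr
      rw [hd]
      have : 0 ≤ c.a + (E + 1 / 2 + q * (1 + c.C)) := by positivity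
      linarith
    linarith
  · intro k hk
    have hk0 : K₀ ≤ k := by omega
    refine (hP.weight_upper k (hK₀.trans hk0)).trans (Real.exp_le_exp.2 ?_)
    have := mul_le_mul_of_nonneg_right (hLk k hk0) (Nat.cast_nonneg (α := ℝ) k)
    linarith
  · omega

/-! ### Rates -/

/-- An argument of at least 2 loses at most half of its value under the floor. -/
theorem le_cutoff {j₀ : ℝ} {n : ℕ} {e X : ℝ} (hX : 1 ≤ X)
    (h : 2 * X ≤ j₀ * n * e ^ 2 / Real.log n) :
    X ≤ cutoff j₀ n e ∧ j₀ * n * e ^ 2 / Real.log n ≤ 2 * cutoff j₀ n e := by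
  have h1 := Nat.lt_floor_add_one (j₀ * n * e ^ 2 / Real.log n)
  unfold cutoff
  constructor <;> linarith

/-- Away from small arguments of the floor, J log n / n and e² are comparable up to constants. The
condition j₀ e² ≤ log n gives J ≤ n, hence L(J) ≤ log J ≤ log n. -/
theorem exists_posteriorRisk_le_rate (L : ℝ → ℝ) (hL_log : ∀ᶠ x in atTop, L x ≤ Real.log x)
    (hL_low : ∃ c : ℝ, 0 < c ∧ ∀ᶠ x in atTop, c ≤ L x) (c : PriorConstants) {j₀ t : ℝ}
    (hj₀ : 0 < j₀) (ht : 0 ≤ t) :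
    ∃ C X : ℝ, 1 ≤ X ∧ ∀ (Pr : SievePrior) (n kn : ℕ) (e : ℝ) (θ₀ : Seq), 3 ≤ n →
      2 * X ≤ j₀ * n * e ^ 2 / Real.log n → j₀ * e ^ 2 ≤ Real.log n →
      PriorCondition c L Pr n (cutoff j₀ n e) kn θ₀ →
      tailSq θ₀ (cutoff j₀ n e) ≤ ENNReal.ofReal (t * e ^ 2) →
      Pr.posteriorRisk n θ₀ ≤ ENNReal.ofReal (C * e ^ 2) := by
  obtain ⟨c₀, hc₀, hlow⟩ := hL_low
  obtain ⟨x₁, hx₁⟩ := eventually_atTop.1 hlow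
  obtain ⟨x₂, hx₂⟩ := eventually_atTop.1 hL_log
  have hb : 0 < c.b * c₀ := mul_pos c.b_pos hc₀
  obtain ⟨C, hC, hrisk⟩ := exists_posteriorRisk_le c hb (A₀ := t * (2 / j₀)) (by positivity)
    (K₀ := max 1 ⌈x₁⌉₊) (le_max_left _ _)
  refine ⟨C * j₀, max 1 x₂, le_max_left _ _, ?_⟩
  intro Pr n kn e θ₀ hn hX he hP htail
  obtain ⟨h1, h2⟩ := le_cutoff (le_max_left _ _) hX
  set J := cutoff j₀ n e with hJ
  have hn' : (0 : ℝ) < n := by positivity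
  have hlog := one_le_log_natCast hn
  have hlog0 : 0 < Real.log n := by linarith
  have hJ1 : (1 : ℝ) ≤ J := (le_max_left _ _).trans h1
  have hJy : (J : ℝ) ≤ j₀ * n * e ^ 2 / Real.log n := Nat.floor_le (by positivity)
  have hJle : J * Real.log n / n ≤ j₀ * e ^ 2 := by
    rw [le_div_iff₀ hlog0] at hJy
    rw [div_le_iff₀ hn']
    linarith
  have hJge : e ^ 2 ≤ 2 / j₀ * (J * Real.log n) / n := by
    rw [div_le_iff₀ hlog0] at h2
    rw [div_mul_eq_mul_div, div_div, le_div_iff₀ (by positivity)]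
    linarith
  have hJn : (J : ℝ) ≤ n := by
    have h3 : J * Real.log n ≤ n * Real.log n := by
      rw [div_le_iff₀ hn'] at hJle
      nlinarith
    exact le_of_mul_le_mul_right h3 hlog0
  refine (hrisk L Pr n J kn θ₀ hn (by exact_mod_cast hJ1) hP ?_ ?_ ?_).trans ?_
  · exact (hx₂ J ((le_max_right _ _).trans h1)).trans (Real.log_le_log (by linarith) hJn)
  · intro k hk
    have := hx₁ k ((Nat.le_ceil x₁).trans (by exact_mod_cast (le_max_right _ _).trans hk))
    exact mul_le_mul_of_nonneg_left this c.b_pos.le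
  · refine htail.trans (ENNReal.ofReal_le_ofReal ?_)
    calc t * e ^ 2 ≤ t * (2 / j₀ * (J * Real.log n) / n) := by gcongr
      _ = _ := by ring
  · refine ENNReal.ofReal_le_ofReal ?_
    rw [mul_assoc]
    gcongr

/-! ### The Kullback-Leibler divergence bounds the squared bias -/

theorem integrable_law_exp (n : ℕ) (θ a : Seq) (s : Finset ℕ) :
    Integrable (fun x : Seq => Real.exp (∑ i ∈ s, a i * x i)) (law n θ) := by
  have hm : Measurable fun x : Seq => Real.exp (∑ i ∈ s, a i * x i) := by fun_prop
  refine ⟨hm.aestronglyMeasurable, ?_⟩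
  rw [hasFiniteIntegral_iff_ofReal (Eventually.of_forall fun _ => Real.exp_nonneg _)]
  have := lintegral_law_exp n θ a s 0
  simp only [add_zero] at this
  rw [this]
  exact ENNReal.ofReal_lt_top

theorem integral_law_exp (n : ℕ) (θ a : Seq) (s : Finset ℕ) :
    ∫ x, Real.exp (∑ i ∈ s, a i * x i) ∂law n θ =
      Real.exp (∑ i ∈ s, (θ i * a i + a i ^ 2 / (2 * n))) := by
  have := lintegral_law_exp n θ a s 0
  simp only [add_zero] at this
  rw [integral_eq_lintegral_of_nonneg_ae (Eventually.of_forall fun _ => Real.exp_nonneg _)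
    (integrable_law_exp n θ a s).aestronglyMeasurable, this,
    ENNReal.toReal_ofReal (Real.exp_nonneg _)]

theorem measurePreserving_law_eval (n : ℕ) (θ : Seq) (i : ℕ) :
    MeasurePreserving (fun x : Seq => x i) (law n θ) (gaussianReal (θ i) ((n : ℝ≥0)⁻¹)) :=
  measurePreserving_eval_infinitePi (fun i => gaussianReal (θ i) ((n : ℝ≥0)⁻¹)) i

theorem integrable_law_eval (n : ℕ) (θ : Seq) (i : ℕ) :
    Integrable (fun x : Seq => x i) (law n θ) := by
  have h : Integrable id (gaussianReal (θ i) ((n : ℝ≥0)⁻¹)) :=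
    (memLp_id_gaussianReal 1).integrable (by norm_num)
  exact (measurePreserving_law_eval n θ i).integrable_comp_of_integrable h

theorem integral_law_eval (n : ℕ) (θ : Seq) (i : ℕ) : ∫ x, x i ∂law n θ = θ i := by
  have h := integral_map (μ := law n θ) (φ := fun x : Seq => x i)
    (measurePreserving_law_eval n θ i).measurable.aemeasurable (f := fun y : ℝ => y)
    (by fun_prop)
  rw [← h, (measurePreserving_law_eval n θ i).map_eq, integral_id_gaussianReal]

/-- The Donsker-Varadhan lower bound on the Kullback-Leibler divergence. -/
theorem integral_sub_log_le_klDiv {𝓧 : Type*} [MeasurableSpace 𝓧] {μ ν : Measure 𝓧}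
    [IsProbabilityMeasure μ] [IsProbabilityMeasure ν] {f : 𝓧 → ℝ} (hf : Integrable f μ)
    (hexp : Integrable (fun x => Real.exp (f x)) ν) (h : InformationTheory.klDiv μ ν ≠ ∞) :
    ∫ x, f x ∂μ - Real.log (∫ x, Real.exp (f x) ∂ν) ≤ (InformationTheory.klDiv μ ν).toReal := by
  obtain ⟨hac, hint⟩ := InformationTheory.klDiv_ne_top_iff.1 h
  -- The inequality is the nonnegativity of the divergence from μ to the measure ν tilted by f.
  have := isProbabilityMeasure_tilted hexp
  have h1 := InformationTheory.integral_llr_add_sub_measure_univ_nonneg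
    (hac.trans (absolutelyContinuous_tilted hexp)) (integrable_llr_tilted_right hac hf hint hexp)
  rw [integral_llr_tilted_right hac hf hexp hint] at h1
  rw [InformationTheory.toReal_klDiv_of_measure_eq hac (by simp)]
  simp only [probReal_univ, add_sub_cancel_right] at h1
  linarith

/-- Donsker-Varadhan with a linear f, equal up to a constant to the log-likelihood ratio on finitely
many coordinates. Its mean is n times the energy, and its log-moment under the projected law,
centred on these coordinates, is half of that. -/
theorem sum_sq_le_klDiv {n : ℕ} (hn : 0 < n) (θ₀ : Seq) (J m : ℕ)
    (h : InformationTheory.klDiv (law n θ₀) (law n (proj J θ₀)) ≠ ∞) :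
    n / 2 * ∑ i ∈ Finset.Ico J m, θ₀ i ^ 2 ≤
      (InformationTheory.klDiv (law n θ₀) (law n (proj J θ₀))).toReal := by
  have hn' : (0 : ℝ) < n := by positivity
  have hdv := integral_sub_log_le_klDiv (f := fun x : Seq => ∑ i ∈ Finset.Ico J m, n * θ₀ i * x i)
    (integrable_finsetSum _ fun i _ => (integrable_law_eval n θ₀ i).const_mul _)
    (integrable_law_exp n (proj J θ₀) (fun i => n * θ₀ i) (Finset.Ico J m)) h
  rw [integral_law_exp n (proj J θ₀) (fun i => n * θ₀ i) (Finset.Ico J m), Real.log_exp,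
    integral_finsetSum _ fun i _ => (integrable_law_eval n θ₀ i).const_mul _,
    ← Finset.sum_sub_distrib] at hdv
  refine le_trans (le_of_eq ?_) hdv
  rw [Finset.mul_sum]
  refine Finset.sum_congr rfl fun i hi => ?_
  rw [integral_const_mul, integral_law_eval, proj, if_neg (not_lt.2 (Finset.mem_Ico.1 hi).1)]
  field_simp
  ring

theorem tailSq_le_of_klDiv_le {n : ℕ} (hn : 0 < n) {θ₀ : Seq} {J : ℕ} {e : ℝ}
    (h : InformationTheory.klDiv (law n θ₀) (law n (proj J θ₀)) ≤ ENNReal.ofReal (n * e ^ 2)) :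
    tailSq θ₀ J ≤ ENNReal.ofReal (2 * e ^ 2) := by
  have hn' : (0 : ℝ) < n := by positivity
  have hne := ne_top_of_le_ne_top ENNReal.ofReal_ne_top h
  refine ENNReal.tsum_le_of_sum_range_le fun m => ?_
  have hsum : ∑ i ∈ Finset.range m, (if J ≤ i then ENNReal.ofReal (θ₀ i ^ 2) else 0) =
      ENNReal.ofReal (∑ i ∈ Finset.Ico J m, θ₀ i ^ 2) := by
    rw [← Finset.sum_filter, ENNReal.ofReal_sum_of_nonneg fun _ _ => sq_nonneg _]
    refine Finset.sum_congr ?_ fun _ _ => rfl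
    ext i
    simp [and_comm]
  rw [hsum]
  refine ENNReal.ofReal_le_ofReal ?_
  have h1 := (sum_sq_le_klDiv hn θ₀ J m hne).trans (ENNReal.toReal_le_of_le_ofReal (by positivity) h)
  have h2 : (n : ℝ) * (∑ i ∈ Finset.Ico J m, θ₀ i ^ 2) ≤ n * (2 * e ^ 2) := by linarith
  exact le_of_mul_le_mul_left h2 hn'

/-! ### Sobolev classes -/

theorem tailSq_le_of_mem_sobolevClass {β L₀ : ℝ} (hβ : 0 ≤ β) {θ₀ : Seq}
    (h : θ₀ ∈ sobolevClass β L₀) {J : ℕ} (hJ : 0 < J) :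
    tailSq θ₀ J ≤ ENNReal.ofReal (L₀ * ((J : ℝ) ^ (2 * β))⁻¹) := by
  have hJ' : (0 : ℝ) < J := by positivity
  have hp : 0 < (J : ℝ) ^ (2 * β) := Real.rpow_pos_of_pos hJ' _
  have hnn : ∀ i : ℕ, 0 ≤ θ₀ i ^ 2 * ((i : ℝ) + 1) ^ (2 * β) := fun i => by positivity
  calc tailSq θ₀ J ≤ ∑' i : ℕ, ENNReal.ofReal
        (θ₀ i ^ 2 * ((i : ℝ) + 1) ^ (2 * β) * ((J : ℝ) ^ (2 * β))⁻¹) := by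
        refine ENNReal.tsum_le_tsum fun i => ?_
        split_ifs with hi
        · refine ENNReal.ofReal_le_ofReal ?_
          rw [mul_assoc]
          refine le_mul_of_one_le_right (sq_nonneg _) ?_
          rw [← div_eq_mul_inv, one_le_div hp]
          have : (J : ℝ) ≤ i := by exact_mod_cast hi
          exact Real.rpow_le_rpow hJ'.le (by linarith) (by linarith)
        · exact zero_le
    _ = ENNReal.ofReal ((∑' i : ℕ, θ₀ i ^ 2 * ((i : ℝ) + 1) ^ (2 * β)) *
          ((J : ℝ) ^ (2 * β))⁻¹) := by
        rw [← tsum_mul_right, ENNReal.ofReal_tsum_of_nonneg (fun i => mul_nonneg (hnn i)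
          (by positivity)) (h.1.mul_right _)]
    _ ≤ _ := by
        refine ENNReal.ofReal_le_ofReal ?_
        have := h.2.le
        gcongr

theorem tendsto_div_log_atTop : Tendsto (fun n : ℕ => (n : ℝ) / Real.log n) atTop atTop := by
  have h1 := (Real.tendsto_pow_log_div_mul_add_atTop 1 0 1 one_ne_zero).comp
    tendsto_natCast_atTop_atTop
  have h2 : Tendsto (fun n : ℕ => Real.log n / n) atTop (𝓝[>] 0) := by
    refine tendsto_nhdsWithin_iff.2 ⟨?_, ?_⟩
    · simpa [Function.comp_def] using h1
    · filter_upwards [eventually_ge_atTop 3] with n hn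
      have := one_le_log_natCast hn
      have : (0 : ℝ) < n := by positivity
      exact div_pos (by linarith) this
  refine (tendsto_inv_nhdsGT_zero.comp h2).congr fun n => ?_
  simp

theorem sobolevRate_sq (ε₀ β : ℝ) {n : ℕ} (hn : 3 ≤ n) :
    sobolevRate ε₀ β n ^ 2 = ε₀ ^ 2 * (((n : ℝ) / Real.log n) ^ (2 * β / (2 * β + 1)))⁻¹ := by
  have hlog := one_le_log_natCast hn
  have hρ : 0 ≤ (n : ℝ) / Real.log n := by positivity
  rw [sobolevRate, ← inv_div, Real.inv_rpow hρ, mul_pow, inv_pow, ← Real.rpow_mul_natCast hρ]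
  have : β / (2 * β + 1) * (2 : ℕ) = 2 * β / (2 * β + 1) := by
    push_cast
    ring
  rw [this]

theorem cutoff_arg_sobolevRate {j₀ ε₀ β : ℝ} (hβ : 0 < 2 * β + 1) {n : ℕ} (hn : 3 ≤ n) :
    j₀ * n * sobolevRate ε₀ β n ^ 2 / Real.log n =
      j₀ * ε₀ ^ 2 * ((n : ℝ) / Real.log n) ^ (1 / (2 * β + 1)) := by
  have hlog := one_le_log_natCast hn
  have hn' : (0 : ℝ) < n := by positivity
  have hρ : 0 < (n : ℝ) / Real.log n := by positivity
  rw [sobolevRate_sq ε₀ β hn]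
  have h1 : 1 / (2 * β + 1) = 1 - 2 * β / (2 * β + 1) := by field_simp; ring
  rw [h1, Real.rpow_sub hρ, Real.rpow_one]
  field_simp

theorem tailSq_le_sobolevRate {j₀ ε₀ β β₂ L₀ : ℝ} (hj₀ : 0 < j₀) (hε₀ : 0 < ε₀) (hβ : 0 < β)
    (hββ₂ : β ≤ β₂) (hL₀ : 0 < L₀) {n : ℕ} (hn : 3 ≤ n) {θ₀ : Seq} (h : θ₀ ∈ sobolevClass β L₀)
    (hJ : 1 ≤ (cutoff j₀ n (sobolevRate ε₀ β n) : ℝ))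
    (hy : j₀ * n * sobolevRate ε₀ β n ^ 2 / Real.log n ≤
      2 * cutoff j₀ n (sobolevRate ε₀ β n)) :
    tailSq θ₀ (cutoff j₀ n (sobolevRate ε₀ β n)) ≤
      ENNReal.ofReal (L₀ * max 1 (2 / (j₀ * ε₀ ^ 2)) ^ (2 * β₂) / ε₀ ^ 2 *
        sobolevRate ε₀ β n ^ 2) := by
  have hβ' : 0 < 2 * β + 1 := by linarith
  set J := cutoff j₀ n (sobolevRate ε₀ β n) with hJdef
  have hlog := one_le_log_natCast hn
  have hn' : (0 : ℝ) < n := by positivity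
  have hρ : 0 < (n : ℝ) / Real.log n := by positivity
  set ρ := (n : ℝ) / Real.log n with hρdef
  refine (tailSq_le_of_mem_sobolevClass hβ.le h (by exact_mod_cast hJ)).trans
    (ENNReal.ofReal_le_ofReal ?_)
  rw [cutoff_arg_sobolevRate hβ' hn] at hy
  rw [sobolevRate_sq ε₀ β hn]
  -- The maximum with 1 allows Q^(2β) to be replaced by Q^(2β₂), which makes the constant uniform in
  -- β.
  set Q := max 1 (2 / (j₀ * ε₀ ^ 2)) with hQ
  have hQ1 : 1 ≤ Q := le_max_left _ _
  have hQJ : ρ ^ (1 / (2 * β + 1)) ≤ Q * J := by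
    calc ρ ^ (1 / (2 * β + 1)) = 1 / (j₀ * ε₀ ^ 2) * (j₀ * ε₀ ^ 2 * ρ ^ (1 / (2 * β + 1))) := by
          field_simp
      _ ≤ 1 / (j₀ * ε₀ ^ 2) * (2 * J) := by gcongr
      _ = 2 / (j₀ * ε₀ ^ 2) * J := by ring
      _ ≤ Q * J := by gcongr; exact le_max_right _ _
  have hpow : ρ ^ (2 * β / (2 * β + 1)) ≤ Q ^ (2 * β₂) * (J : ℝ) ^ (2 * β) := by
    calc ρ ^ (2 * β / (2 * β + 1)) = (ρ ^ (1 / (2 * β + 1))) ^ (2 * β) := by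
          rw [← Real.rpow_mul hρ.le]
          ring_nf
      _ ≤ (Q * J) ^ (2 * β) := by gcongr
      _ = Q ^ (2 * β) * (J : ℝ) ^ (2 * β) := Real.mul_rpow (by linarith) (by linarith)
      _ ≤ _ := by gcongr
  have hJp : 0 < (J : ℝ) ^ (2 * β) := Real.rpow_pos_of_pos (by linarith) _
  have hρp : 0 < ρ ^ (2 * β / (2 * β + 1)) := Real.rpow_pos_of_pos hρ _
  calc L₀ * ((J : ℝ) ^ (2 * β))⁻¹ ≤ L₀ * (Q ^ (2 * β₂) * (ρ ^ (2 * β / (2 * β + 1)))⁻¹) := by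
        gcongr
        rw [← div_eq_mul_inv, le_div_iff₀ hρp, inv_mul_le_iff₀ hJp]
        linarith
    _ = _ := by
        rw [← hρdef]
        field_simp

end WhiteNoise

end

/-! ### The two statements: a general rate, and adaptation over Sobolev classes. -/

theorem mainTheorem5
    -- the sieve priors, one for each sample size, and the function in the condition on them
    (Pr : ℕ → SievePrior) (L : ℝ → ℝ) (hL : IsSlowlyVarying L)
    (hL_log : ∀ᶠ x in atTop, L x ≤ Real.log x)
    (hL_low : ∃ c : ℝ, 0 < c ∧ ∀ᶠ x in atTop, c ≤ L x)
    (j₀ M₀ m : ℝ) (hj₀ : 0 < j₀) (hM₀ : 1 < M₀) (hm : 5 ≤ m) :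
    -- a fixed true parameter and a general rate
    (∀ (θ₀ : Seq) (ε : ℕ → ℝ),
      Summable (fun i => θ₀ i ^ 2) →
      (∀ n, 1 ≤ n → 0 < ε n) →
      Tendsto ε atTop (𝓝 0) →
      Tendsto (fun n : ℕ => n * ε n ^ 2 / Real.log n) atTop atTop →
      (∀ᶠ n : ℕ in atTop, ApproximationCondition m n (cutoff j₀ n (ε n)) (ε n) θ₀) →
      (∃ c : PriorConstants, ∀ᶠ n : ℕ in atTop,
        PriorCondition c L (Pr n) n (cutoff j₀ n (ε n)) (upperCutoff L j₀ M₀ n (ε n)) θ₀) →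
      ∃ C : ℝ, ∀ᶠ n : ℕ in atTop,
        (Pr n).posteriorRisk n θ₀ ≤ ENNReal.ofReal (C * ε n ^ 2)) ∧
    -- adaptation: the bound holds uniformly over a scale of Sobolev classes
    (∀ (β₁ β₂ L₀ ε₀ : ℝ), 1 / 2 < β₁ → β₁ ≤ β₂ → 0 < L₀ → 0 < ε₀ →
      (∃ C₀ : ℝ, 0 < C₀ ∧ ∀ᶠ n : ℕ in atTop,
        ∀ β ∈ Set.Icc β₁ β₂, ∀ θ₀ ∈ sobolevClass β L₀,
          ComparisonCondition m C₀ n (cutoff j₀ n (sobolevRate ε₀ β n)) θ₀) →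
      (∃ c : PriorConstants, ∀ᶠ n : ℕ in atTop,
        ∀ β ∈ Set.Icc β₁ β₂, ∀ θ₀ ∈ sobolevClass β L₀,
          PriorCondition c L (Pr n) n (cutoff j₀ n (sobolevRate ε₀ β n))
            (upperCutoff L j₀ M₀ n (sobolevRate ε₀ β n)) θ₀) →
      ∃ C : ℝ, ∀ᶠ n : ℕ in atTop,
        ∀ β ∈ Set.Icc β₁ β₂, ∀ θ₀ ∈ sobolevClass β L₀,
          (Pr n).posteriorRisk n θ₀ ≤ ENNReal.ofReal (C * sobolevRate ε₀ β n ^ 2)) := by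
  constructor
  · intro θ₀ ε _ _ hε hnε happ ⟨c, hc⟩
    obtain ⟨C, X, _, hC⟩ := exists_posteriorRisk_le_rate L hL_log hL_low c hj₀ zero_le_two
    refine ⟨C, ?_⟩
    have hε1 : ∀ᶠ n : ℕ in atTop, j₀ * ε n ^ 2 ≤ Real.log n := by
      have h1 : Tendsto (fun n => j₀ * ε n ^ 2) atTop (𝓝 0) := by
        simpa using (hε.pow 2).const_mul j₀
      filter_upwards [h1.eventually_le_const zero_lt_one, eventually_ge_atTop 3] with n hn hn3
      exact hn.trans (one_le_log_natCast hn3)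
    filter_upwards [happ, hc, hε1, hnε.eventually_ge_atTop (2 * X / j₀), eventually_ge_atTop 3]
      with n h1 h2 h3 h4 h5
    refine hC (Pr n) n _ (ε n) θ₀ h5 ?_ h3 h2 (tailSq_le_of_klDiv_le (by omega) h1.1)
    rw [div_le_iff₀ hj₀] at h4
    refine h4.trans (le_of_eq ?_)
    ring
  · intro β₁ β₂ L₀ ε₀ hβ₁ hβ hL₀ hε₀ _ ⟨c, hc⟩
    obtain ⟨C, X, hX1, hC⟩ := exists_posteriorRisk_le_rate L hL_log hL_low c hj₀
      (t := L₀ * max 1 (2 / (j₀ * ε₀ ^ 2)) ^ (2 * β₂) / ε₀ ^ 2) (by positivity)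
    refine ⟨C, ?_⟩
    -- Once n / log n ≥ 1, the cutoff argument is smallest at β₂, so its divergence there gives a
    -- threshold in n valid for all β.
    have hlim : Tendsto (fun n : ℕ => j₀ * ε₀ ^ 2 * ((n : ℝ) / Real.log n) ^ (1 / (2 * β₂ + 1)))
        atTop atTop := by
      refine Tendsto.const_mul_atTop (by positivity) ?_
      exact (tendsto_rpow_atTop (by apply div_pos one_pos; linarith)).comp tendsto_div_log_atTop
    have hlog : ∀ᶠ n : ℕ in atTop, j₀ * ε₀ ^ 2 ≤ Real.log n :=
      (Real.tendsto_log_atTop.comp tendsto_natCast_atTop_atTop).eventually_ge_atTop _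
    filter_upwards [hc, hlim.eventually_ge_atTop (2 * X), hlog,
      tendsto_div_log_atTop.eventually_ge_atTop 1, eventually_ge_atTop 3] with n h1 h2 h3 h4 h5
    intro β hβm θ₀ hθ₀
    have hβ0 : 0 < β := by linarith [hβm.1]
    have hβ' : 0 < 2 * β + 1 := by linarith
    have hy : 2 * X ≤ j₀ * n * sobolevRate ε₀ β n ^ 2 / Real.log n := by
      rw [cutoff_arg_sobolevRate hβ' h5]
      refine h2.trans ?_
      have := hβm.2
      gcongr
    obtain ⟨hJ, hJy⟩ := le_cutoff hX1 hy
    refine hC (Pr n) n _ _ θ₀ h5 hy ?_ (h1 β hβm θ₀ hθ₀)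
      (tailSq_le_sobolevRate hj₀ hε₀ hβ0 hβm.2 hL₀ h5 hθ₀ (hX1.trans hJ) hJy)
    refine le_trans ?_ h3
    rw [sobolevRate_sq ε₀ β h5]
    gcongr
    refine mul_le_of_le_one_right (by positivity) (inv_le_one_of_one_le₀ ?_)
    exact Real.one_le_rpow h4 (by positivity)
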